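/- Let $d\ge 3$ be odd. Let $|\Omega\rangle=d^{-1/2}\sum_{j=1}^d|j,j\rangle\in\mathbb C^d\otimes\mathbb C^d$, and let $\rho_T=(\mathrm{id}\otimes T)(|\Omega\rangle\langle\Omega|)$ be the Jamiolkowski state of a linear map $T:M_d\to M_d$. Let $\mathcal S$ be the set of all $\rho_T$ with $T$ completely positive, trace preserving and unital, let $\mathcal U$ be the convex hull of the states $(1\otimes U)|\Omega\rangle\langle\Omega|(1\otimes U^\dagger)$ with $U\in U(d)$ (the mixtures of unitary channels), and for $\rho\in\mathcal S$ let $$\mathcal N_{\mathcal U}(\rho)=\inf\{\alpha_n : \rho=\alpha_p\sigma_p-\alpha_n\sigma_n,\ \alpha_p,\alpha_n\ge 0,\ \sigma_p,\sigma_n\in\mathcal U\}.$$ Let $G'$ be the commutant of $\{O\otimes O : O\in M_d \text{ real orthogonal}\}$; thus $\mathcal S\cap G'$ is the set of Jamiolkowski states of $O(d)$-covariant unital channels. Let $\mathbb F|k,l\rangle=|l,k\rangle$, $P_0=|\Omega\rangle\langle\Omega|$, $P_1=\tfrac12(1-\mathbb F)$, $P_2=\tfrac12(1+\mathbb F)-|\Omega\rangle\langle\Omega|$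 and $\rho_i=P_i/\mathrm{tr}\,P_i$. 1. $\mathcal S\cap G'=\{\sum_{i=0}^2 q_i\rho_i : q_i\ge 0,\ \sum_i q_i=1\}$; the coefficients $q_i$ are determined by $\rho$, and every $\rho\in\mathcal S\cap G'$ has a decomposition as in the definition of $\mathcal N_{\mathcal U}(\rho)$. 2. Let $\rho=\sum_i q_i\rho_i$ with $q_i\ge 0$ and $\sum_i q_i=1$, and suppose $\rho\notin\mathcal U$. Then $q_1>0$, and with $q:=q_0/q_1$: - if $q\le\frac1{d(d-1)}$, then $\mathcal N_{\mathcal U}(\rho)=\frac{d}{d-1}q_1-1$; - if $q>\frac1{d(d-1)}$, then $$\mathcal N_{\mathcal U}(\rho)=\frac1{d-2}\left(d-1+\Big(d+\frac2{d-2}\Big)q-2\,\frac{d-1}{d-2}\sqrt{q^2+\frac{d-2}{d-1}\,q}\right)q_1-1 .$$ 3. The Werner–Holevo channel $T(X)=(\mathrm{tr}[X]\,1-X^T)/(d-1)$ has Jamiolkowski state $\rho_1$, which lies in $(\mathcal S\cap G')\setminus\mathcal U$. For every $\rho\in\mathcal S\cap G'$ one has $\mathcal N_{\mathcal U}(\rho)\le\frac1{d-1}$,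 with equality if and only if $\rho=\rho_1$. -/

import Mathlib

open scoped ComplexOrder Kronecker

/-- Operators on `ℂ^d ⊗ ℂ^d`, as matrices indexed by pairs. -/
abbrev BipMat (d : ℕ) : Type := Matrix (Fin d × Fin d) (Fin d × Fin d) ℂ

/-- The ampliation `id ⊗ T`, acting on each `(i, j)` block of a block matrix by `T`. -/
def ampliation {d : ℕ} {κ : Type*}
    (T : Matrix (Fin d) (Fin d) ℂ →ₗ[ℂ] Matrix (Fin d) (Fin d) ℂ)
    (X : Matrix (κ × Fin d) (κ × Fin d) ℂ) : Matrix (κ × Fin d) (κ × Fin d) ℂ :=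
  Matrix.of fun p q => T (Matrix.of fun a b => X (p.1, a) (q.1, b)) p.2 q.2

/-- Complete positivity: every ampliation `id_n ⊗ T` preserves positive semidefiniteness. -/
def IsCompletelyPositive {d : ℕ}
    (T : Matrix (Fin d) (Fin d) ℂ →ₗ[ℂ] Matrix (Fin d) (Fin d) ℂ) : Prop :=
  ∀ (n : ℕ) (X : Matrix (Fin n × Fin d) (Fin n × Fin d) ℂ),
    X.PosSemidef → (ampliation T X).PosSemidef

/-- Unital (doubly stochastic) quantum channels. -/
structure IsUnitalChannel {d : ℕ}
    (T : Matrix (Fin d) (Fin d) ℂ →ₗ[ℂ] Matrix (Fin d) (Fin d) ℂ) : Prop where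
  completelyPositive : IsCompletelyPositive T
  tracePreserving : ∀ X, (T X).trace = X.trace
  unital : T 1 = 1

/-- The maximally entangled vector `Ω = d^(-1/2) ∑ⱼ |j,j⟩`. -/
noncomputable def omegaVec (d : ℕ) : Fin d × Fin d → ℂ :=
  fun p => if p.1 = p.2 then ((1 / Real.sqrt d : ℝ) : ℂ) else 0

/-- The maximally entangled state `|Ω⟩⟨Ω|`. -/
noncomputable def omegaState (d : ℕ) : BipMat d :=
  Matrix.vecMulVec (omegaVec d) (star (omegaVec d))

/-- The Jamiolkowski state `(id ⊗ T)(|Ω⟩⟨Ω|)`. -/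
noncomputable def jamiolkowski {d : ℕ}
    (T : Matrix (Fin d) (Fin d) ℂ →ₗ[ℂ] Matrix (Fin d) (Fin d) ℂ) : BipMat d :=
  ampliation T (omegaState d)

/-- The set `𝒮` of Jamiolkowski states of unital channels on `M_d`. -/
def unitalStates (d : ℕ) : Set (BipMat d) :=
  {ρ | ∃ T : Matrix (Fin d) (Fin d) ℂ →ₗ[ℂ] Matrix (Fin d) (Fin d) ℂ,
    IsUnitalChannel T ∧ jamiolkowski T = ρ}

/-- The set `𝒰` of Jamiolkowski states of mixtures of unitary channels. -/
def unitaryMixtures (d : ℕ) : Set (BipMat d) :=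
  convexHull ℝ {σ | ∃ U ∈ Matrix.unitaryGroup (Fin d) ℂ,
    σ = ((1 : Matrix (Fin d) (Fin d) ℂ) ⊗ₖ U) * omegaState d *
      ((1 : Matrix (Fin d) (Fin d) ℂ) ⊗ₖ U.conjTranspose)}

/-- The weights `αₙ` occurring in decompositions `ρ = αₚ σₚ - αₙ σₙ` with `αₚ, αₙ ≥ 0` and
`σₚ, σₙ ∈ 𝒰`. -/
def negativeWeights (d : ℕ) (ρ : BipMat d) : Set ℝ :=
  {αn | 0 ≤ αn ∧ ∃ αp : ℝ, 0 ≤ αp ∧ ∃ σp ∈ unitaryMixtures d, ∃ σn ∈ unitaryMixtures d,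
    ρ = αp • σp - αn • σn}

/-- The negativity `𝒩_𝒰(ρ)`. -/
noncomputable def negativity (d : ℕ) (ρ : BipMat d) : ℝ :=
  sInf (negativeWeights d ρ)

/-- The commutant `G'` of `G = {O ⊗ O : O real orthogonal}`. -/
def orthogonalCommutant (d : ℕ) : Set (BipMat d) :=
  {X | ∀ O ∈ Matrix.orthogonalGroup (Fin d) ℝ,
    X * (O.map Complex.ofReal ⊗ₖ O.map Complex.ofReal) =
      (O.map Complex.ofReal ⊗ₖ O.map Complex.ofReal) * X}

/-- The flip operator `|k,l⟩ ↦ |l,k⟩`. -/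
def flipOp (d : ℕ) : BipMat d :=
  Matrix.of fun p q => if p.1 = q.2 ∧ p.2 = q.1 then 1 else 0

/-- The minimal projections `P₀, P₁, P₂` of the commutant `G'`. -/
noncomputable def minimalProj (d : ℕ) : Fin 3 → BipMat d :=
  ![omegaState d,
    (1 / 2 : ℂ) • (1 - flipOp d),
    (1 / 2 : ℂ) • (1 + flipOp d) - omegaState d]

/-- The normalized density matrices `ρᵢ = Pᵢ / tr Pᵢ`. -/
noncomputable def extremeState (d : ℕ) (i : Fin 3) : BipMat d :=
  (minimalProj d i).trace⁻¹ • minimalProj d i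

/-- The convex combination `∑ᵢ qᵢ ρᵢ`. -/
noncomputable def covariantState (d : ℕ) (q : Fin 3 → ℝ) : BipMat d :=
  ∑ i, q i • extremeState d i

/-- The Werner–Holevo channel `X ↦ (tr X · 1 - Xᵀ) / (d - 1)`. -/
noncomputable def wernerHolevo (d : ℕ) :
    Matrix (Fin d) (Fin d) ℂ →ₗ[ℂ] Matrix (Fin d) (Fin d) ℂ where
  toFun X := ((d : ℂ) - 1)⁻¹ • (X.trace • (1 : Matrix (Fin d) (Fin d) ℂ) - X.transpose)
  map_add' X Y := by
    rw [Matrix.trace_add, Matrix.transpose_add, ← smul_add, add_smul]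
    congr 1
    abel
  map_smul' c X := by
    rw [Matrix.trace_smul, Matrix.transpose_smul, RingHom.id_apply, smul_comm c, smul_sub c,
      smul_assoc]

/-! The problem becomes planar convex geometry. The algebra `G'` is spanned by the projections `P₀,
P₁, P₂`, so a trace-one Hermitian element of it is a point `(x, y) = (tr P₀ρ, tr P₁ρ)`. Averaging
over `O ⊗ O` keeps both coordinates and stays in `𝒰` (`twirl_mem_unitaryMixtures`), so a unitary `U`
contributes the point with `x = |tr U|² / d²` and `y = (1 - tr(U Ū) / d) / 2`.

Oddness of `d` enters once: `U - Uᵀ` is antisymmetric of odd size, hence singular, so `U` and its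
symmetric part `S` agree on some unit vector. This forces `‖S‖² ≥ 1` in the Hilbert–Schmidt norm,
hence `y ≤ (d-1)/d`. Removing the rank-one piece of `S` on that vector and applying Cauchy–Schwarz
to the rest bounds `|tr U|` (`norm_trace_le_of_unitary`). The result is a family of half-planes,
indexed by `c ≥ 0`, containing all of `𝒰` (`projWeight_le_of_mem_unitaryMixtures`). The lines with
`c ≤ 1` are touched by the curve of unitaries `(c + sJ) ⊕ 1`, `c² + s² = 1`
(`planarState_curve_mem`), and the line `c = 0` also at `x = 0` (`planarState_zero_max_mem`).

The origin `(0, 0)` is `ρ₂`, which lies in `𝒰`. Take the ray from the origin through a state outside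
`𝒰`, and let `(x, y)` be the point where it meets this boundary, so that the state is `(ax, ay)`
with `a ≥ 1`. This writes the state as `aσ - (a-1)ρ₂`. The supporting functional at `σ`, scaled to
be 1 there, vanishes at `ρ₂` and takes values in `[0, 1]` on `𝒰`, so no decomposition has smaller
negative weight (`isLeast_negativeWeights`). The two cases of the formula are the flat edge `y =
(d-1)/d` and the curved arc; they meet at slope `x/y = 1/(d(d-1))`. -/

/-! ### Algebra of `Ω`, the flip and the minimal projections. -/

theorem omegaState_apply {d : ℕ} (p q : Fin d × Fin d) :
    omegaState d p q = if p.1 = p.2 ∧ q.1 = q.2 then (d : ℂ)⁻¹ else 0 := by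
  have h : ((1 / Real.sqrt d : ℝ) : ℂ) * ((1 / Real.sqrt d : ℝ) : ℂ) = (d : ℂ)⁻¹ := by
    rw [← Complex.ofReal_mul, div_mul_div_comm, Real.mul_self_sqrt (Nat.cast_nonneg d)]
    simp
  simp only [omegaState, Matrix.vecMulVec_apply, omegaVec, Pi.star_apply]
  by_cases h1 : p.1 = p.2 <;> by_cases h2 : q.1 = q.2
  · simp only [h1, h2, if_true, and_self]
    rw [Complex.star_def, Complex.conj_ofReal, h]
  all_goals simp [h1, h2]

theorem flipOp_apply {d : ℕ} (p q : Fin d × Fin d) :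
    flipOp d p q = if q = p.swap then 1 else 0 := by
  simp only [flipOp, Matrix.of_apply, Prod.ext_iff, Prod.fst_swap, Prod.snd_swap]
  congr 1
  exact propext ⟨fun h => ⟨h.2.symm, h.1.symm⟩, fun h => ⟨h.2.symm, h.1.symm⟩⟩

theorem flipOp_mul_apply {d : ℕ} (X : BipMat d) (p q : Fin d × Fin d) :
    (flipOp d * X) p q = X p.swap q := by
  simp [Matrix.mul_apply, flipOp_apply]

theorem mul_flipOp_apply {d : ℕ} (X : BipMat d) (p q : Fin d × Fin d) :
    (X * flipOp d) p q = X p q.swap := by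
  have h (r : Fin d × Fin d) : q = r.swap ↔ r = q.swap := by
    constructor <;> rintro rfl <;> simp
  simp [Matrix.mul_apply, flipOp_apply, h]

theorem sum_prod_diag {d : ℕ} (f : Fin d × Fin d → ℂ) :
    ∑ p : Fin d × Fin d, (if p.1 = p.2 then f p else 0) = ∑ i, f (i, i) := by
  rw [Fintype.sum_prod_type]
  simp

theorem omegaState_mul_apply {d : ℕ} (X : BipMat d) (p q : Fin d × Fin d) :
    (omegaState d * X) p q = if p.1 = p.2 then (d : ℂ)⁻¹ * ∑ i, X (i, i) q else 0 := by
  simp only [Matrix.mul_apply, omegaState_apply, ite_and, ite_mul, zero_mul]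
  split_ifs with h
  · rw [sum_prod_diag (fun r => (d : ℂ)⁻¹ * X r q), Finset.mul_sum]
  · simp

theorem flipOp_mul_flipOp (d : ℕ) : flipOp d * flipOp d = 1 := by
  ext p q
  rw [flipOp_mul_apply, flipOp_apply, Prod.swap_swap, Matrix.one_apply]
  exact if_congr eq_comm rfl rfl

theorem flipOp_mul_omegaState (d : ℕ) : flipOp d * omegaState d = omegaState d := by
  ext p q
  rw [flipOp_mul_apply, omegaState_apply, omegaState_apply]
  exact if_congr (and_congr_left fun _ => eq_comm) rfl rfl

theorem omegaState_mul_flipOp (d : ℕ) : omegaState d * flipOp d = omegaState d := by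
  ext p q
  rw [mul_flipOp_apply, omegaState_apply, omegaState_apply]
  exact if_congr (and_congr_right fun _ => eq_comm) rfl rfl

theorem omegaState_mul_omegaState {d : ℕ} (hd : d ≠ 0) :
    omegaState d * omegaState d = omegaState d := by
  ext p q
  have hd' : (d : ℂ) ≠ 0 := Nat.cast_ne_zero.mpr hd
  rw [omegaState_mul_apply]
  simp only [omegaState_apply, true_and, ite_and]
  split_ifs
  · simp [hd']
  · simp
  · rfl

theorem conjTranspose_flipOp (d : ℕ) : (flipOp d).conjTranspose = flipOp d := by
  ext p q
  simp only [Matrix.conjTranspose_apply, flipOp_apply]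
  have : p = q.swap ↔ q = p.swap := by constructor <;> rintro rfl <;> simp
  simp [this]

theorem conjTranspose_omegaState (d : ℕ) : (omegaState d).conjTranspose = omegaState d := by
  ext p q
  simp only [Matrix.conjTranspose_apply, omegaState_apply]
  split_ifs with h1 h2 h2
  · simp
  · exact absurd h1.symm h2
  · exact absurd h2.symm h1
  · simp

theorem trace_omegaState {d : ℕ} (hd : d ≠ 0) : (omegaState d).trace = 1 := by
  have hd' : (d : ℂ) ≠ 0 := Nat.cast_ne_zero.mpr hd
  simp only [Matrix.trace, Matrix.diag_apply, omegaState_apply, and_self]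
  rw [sum_prod_diag fun _ => (d : ℂ)⁻¹]
  simp [hd']

theorem trace_flipOp (d : ℕ) : (flipOp d).trace = d := by
  have h (p : Fin d × Fin d) : p = p.swap ↔ p.1 = p.2 := by
    simp only [Prod.ext_iff, Prod.fst_swap, Prod.snd_swap]
    exact ⟨fun h => h.1, fun h => ⟨h, h.symm⟩⟩
  simp only [Matrix.trace, Matrix.diag_apply, flipOp_apply, h]
  rw [sum_prod_diag fun _ => (1 : ℂ)]
  simp

/-- The dimensions of the ranges of the projections `minimalProj d i`. -/
noncomputable def projRank (d : ℕ) : Fin 3 → ℝ :=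
  ![1, d * (d - 1) / 2, d * (d + 1) / 2 - 1]

theorem trace_minimalProj {d : ℕ} (hd : d ≠ 0) (i : Fin 3) :
    (minimalProj d i).trace = (projRank d i : ℂ) := by
  fin_cases i
  · simp [minimalProj, projRank, trace_omegaState hd]
  · simp [minimalProj, projRank, trace_flipOp]
    ring
  · simp [minimalProj, projRank, trace_flipOp, trace_omegaState hd]
    ring

theorem projRank_pos {d : ℕ} (hd : 2 ≤ d) (i : Fin 3) : 0 < projRank d i := by
  have hd' : (2 : ℝ) ≤ d := by exact_mod_cast hd
  fin_cases i
  · simp [projRank]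
  · simp only [projRank, Fin.mk_one, Matrix.cons_val_one, Matrix.cons_val_zero]
    nlinarith
  · simp only [projRank, Fin.reduceFinMk, Matrix.cons_val]
    nlinarith

theorem conjTranspose_minimalProj (d : ℕ) (i : Fin 3) :
    (minimalProj d i).conjTranspose = minimalProj d i := by
  fin_cases i <;>
    simp [minimalProj, conjTranspose_omegaState, conjTranspose_flipOp]

theorem minimalProj_mul_self {d : ℕ} (hd : d ≠ 0) (i : Fin 3) :
    minimalProj d i * minimalProj d i = minimalProj d i := by
  fin_cases i
  · exact omegaState_mul_omegaState hd
  · simp only [minimalProj, Fin.mk_one, Matrix.cons_val_one, Matrix.cons_val_zero]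
    simp only [Matrix.smul_mul, Matrix.mul_smul, mul_sub, sub_mul, flipOp_mul_flipOp, mul_one,
      one_mul]
    module
  · simp only [minimalProj, Fin.reduceFinMk, Matrix.cons_val]
    simp only [Matrix.smul_mul, Matrix.mul_smul, mul_sub, sub_mul, mul_add, add_mul, flipOp_mul_flipOp,
      mul_one, one_mul, flipOp_mul_omegaState, omegaState_mul_flipOp,
      omegaState_mul_omegaState hd]
    module

theorem minimalProj_mul_of_ne {d : ℕ} (hd : d ≠ 0) {i j : Fin 3} (hij : i ≠ j) :
    minimalProj d i * minimalProj d j = 0 := by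
  fin_cases i <;> fin_cases j <;> first | exact absurd rfl hij | skip
  all_goals
    simp only [minimalProj, Fin.reduceFinMk, Fin.mk_one, Fin.zero_eta, Matrix.cons_val,
      Matrix.cons_val_one, Matrix.cons_val_zero]
    simp only [Matrix.smul_mul, Matrix.mul_smul, mul_sub, sub_mul, mul_add, add_mul, flipOp_mul_flipOp,
      mul_one, one_mul, flipOp_mul_omegaState, omegaState_mul_flipOp,
      omegaState_mul_omegaState hd]
    module

theorem sum_minimalProj (d : ℕ) : ∑ i, minimalProj d i = 1 := by
  simp only [Fin.sum_univ_three, minimalProj, Matrix.cons_val, Matrix.cons_val_one,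
    Matrix.cons_val_zero]
  module

theorem posSemidef_minimalProj {d : ℕ} (hd : d ≠ 0) (i : Fin 3) :
    (minimalProj d i).PosSemidef := by
  have h := Matrix.posSemidef_conjTranspose_mul_self (minimalProj d i)
  rwa [conjTranspose_minimalProj, minimalProj_mul_self hd] at h

/-! ### Coordinates `tr (Pᵢ X)` and covariant states. -/

/-- The weight `tr (Pᵢ X)` of an operator on the range of `Pᵢ`. -/
noncomputable def projWeight {d : ℕ} (i : Fin 3) : BipMat d →ₗ[ℝ] ℝ where
  toFun X := (minimalProj d i * X).trace.re
  map_add' X Y := by simp [mul_add]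
  map_smul' c X := by simp

theorem projWeight_apply {d : ℕ} (i : Fin 3) (X : BipMat d) :
    projWeight i X = (minimalProj d i * X).trace.re := rfl

theorem trace_minimalProj_mul_extremeState {d : ℕ} (hd : 2 ≤ d) (i j : Fin 3) :
    (minimalProj d i * extremeState d j).trace = if i = j then 1 else 0 := by
  have h0 : d ≠ 0 := by omega
  rw [extremeState, Matrix.mul_smul, Matrix.trace_smul]
  split_ifs with h
  · subst h
    rw [minimalProj_mul_self h0, trace_minimalProj h0, smul_eq_mul, inv_mul_cancel₀]
    exact_mod_cast (projRank_pos hd i).ne'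
  · rw [minimalProj_mul_of_ne h0 h]
    simp

theorem projWeight_covariantState {d : ℕ} (hd : 2 ≤ d) (q : Fin 3 → ℝ) (i : Fin 3) :
    projWeight i (covariantState d q) = q i := by
  rw [covariantState, map_sum]
  simp [projWeight_apply, trace_minimalProj_mul_extremeState hd, apply_ite Complex.re]

theorem sum_projWeight {d : ℕ} (X : BipMat d) : ∑ i, projWeight i X = X.trace.re := by
  simp only [projWeight_apply]
  rw [← Complex.re_sum, ← Matrix.trace_sum, ← Finset.sum_mul, sum_minimalProj, one_mul]

theorem extremeState_eq_smul {d : ℕ} (hd : d ≠ 0) (i : Fin 3) :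
    extremeState d i = (projRank d i)⁻¹ • minimalProj d i := by
  rw [extremeState, trace_minimalProj hd, ← Complex.ofReal_inv]
  rfl

theorem covariantState_eq_sum {d : ℕ} (hd : d ≠ 0) (q : Fin 3 → ℝ) :
    covariantState d q = ∑ i, (q i / projRank d i) • minimalProj d i := by
  simp only [covariantState, extremeState_eq_smul hd, smul_smul, div_eq_mul_inv]

theorem posSemidef_covariantState {d : ℕ} (hd : 2 ≤ d) {q : Fin 3 → ℝ} (hq : ∀ i, 0 ≤ q i) :
    (covariantState d q).PosSemidef := by
  rw [covariantState_eq_sum (by omega)]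
  refine Matrix.posSemidef_sum _ fun i _ => ?_
  exact (posSemidef_minimalProj (by omega) i).smul (div_nonneg (hq i) (projRank_pos hd i).le)

theorem covariantState_add {d : ℕ} (p q : Fin 3 → ℝ) :
    covariantState d (p + q) = covariantState d p + covariantState d q := by
  simp [covariantState, add_smul, Finset.sum_add_distrib]

theorem covariantState_smul {d : ℕ} (c : ℝ) (q : Fin 3 → ℝ) :
    covariantState d (c • q) = c • covariantState d q := by
  simp [covariantState, mul_smul, Finset.smul_sum]

/-! ### The commutant of `O ⊗ O`. -/

/-- The sums are nested one index at a time so that a sparse `O` collapses each of them separately.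
-/
theorem commutant_sum_eq {d : ℕ} {X : BipMat d} (hX : X ∈ orthogonalCommutant d)
    {O : Matrix (Fin d) (Fin d) ℝ} (hO : O ∈ Matrix.orthogonalGroup (Fin d) ℝ)
    (i j k l : Fin d) :
    ∑ m, (O m k : ℂ) * ∑ n, (O n l : ℂ) * X (i, j) (m, n) =
      ∑ m, (O i m : ℂ) * ∑ n, (O j n : ℂ) * X (m, n) (k, l) := by
  have h := congrFun (congrFun (hX O hO) (i, j)) (k, l)
  simp only [Matrix.mul_apply, Matrix.kronecker_apply, Matrix.map_apply,
    Fintype.sum_prod_type] at h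
  simp only [Finset.mul_sum]
  calc _ = _ := Finset.sum_congr rfl fun m _ => Finset.sum_congr rfl fun n _ => by ring
    _ = _ := h
    _ = _ := Finset.sum_congr rfl fun m _ => Finset.sum_congr rfl fun n _ => by ring

theorem commutant_sign {d : ℕ} {X : BipMat d} (hX : X ∈ orthogonalCommutant d)
    {ε : Fin d → ℝ} (hε : ∀ i, ε i * ε i = 1) (i j k l : Fin d) :
    (ε k * (ε l * X (i, j) (k, l)) : ℂ) = ε i * (ε j * X (i, j) (k, l)) := by
  have hO : Matrix.diagonal ε ∈ Matrix.orthogonalGroup (Fin d) ℝ := by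
    rw [Matrix.mem_orthogonalGroup_iff, Matrix.diagonal_transpose, Matrix.diagonal_mul_diagonal]
    simp [hε]
  simpa [Matrix.diagonal_apply, apply_ite Complex.ofReal] using commutant_sum_eq hX hO i j k l

/-- Flipping the sign of one basis vector shows that in a nonzero entry every index value occurs an
even number of times. Testing the values `i`, `j`, `k` suffices, since the total is four. -/
theorem commutant_apply_eq_zero {d : ℕ} {X : BipMat d} (hX : X ∈ orthogonalCommutant d)
    {i j k l : Fin d} (h : ¬((i = j ∧ k = l) ∨ (i = k ∧ j = l) ∨ (i = l ∧ j = k))) :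
    X (i, j) (k, l) = 0 := by
  by_contra hne
  have key (a : Fin d) := commutant_sign hX (ε := fun b => if b = a then -1 else 1)
    (fun b => by split_ifs <;> norm_num) i j k l
  have hi := key i
  have hj := key j
  have hk := key k
  have hneg : ¬ (X (i, j) (k, l) = -X (i, j) (k, l)) := fun h => hne (self_eq_neg.mp h)
  simp only [apply_ite Complex.ofReal, Complex.ofReal_neg, Complex.ofReal_one] at hi hj hk
  grind

theorem commutant_perm {d : ℕ} {X : BipMat d} (hX : X ∈ orthogonalCommutant d)
    (π : Equiv.Perm (Fin d)) (i j k l : Fin d) :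
    X (π i, π j) (π k, π l) = X (i, j) (k, l) := by
  have hO : (Matrix.of fun a b => if a = π b then (1 : ℝ) else 0) ∈
      Matrix.orthogonalGroup (Fin d) ℝ := by
    rw [Matrix.mem_orthogonalGroup_iff']
    ext a b
    simp [Matrix.mul_apply, Matrix.one_apply, eq_comm]
  have h (a b : Fin d) : π a = π b ↔ b = a := by rw [π.injective.eq_iff, eq_comm]
  simpa [apply_ite Complex.ofReal, h] using commutant_sum_eq hX hO (π i) (π j) k l

theorem exists_perm_pair {α : Type*} [DecidableEq α] {x y i k : α} (hxy : x ≠ y) (hik : i ≠ k) :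
    ∃ π : Equiv.Perm α, π x = i ∧ π y = k := by
  refine ⟨Equiv.swap (Equiv.swap x i y) k * Equiv.swap x i, ?_, ?_⟩
  · rw [Equiv.Perm.mul_apply, Equiv.swap_apply_left, Equiv.swap_apply_of_ne_of_ne _ hik]
    intro h
    have h' := congrArg (Equiv.swap x i) h
    rw [Equiv.swap_apply_right, Equiv.swap_apply_self] at h'
    exact hxy h'
  · rw [Equiv.Perm.mul_apply, Equiv.swap_apply_left]

theorem commutant_apply_diag {d : ℕ} {X : BipMat d} (hX : X ∈ orthogonalCommutant d)
    {a b : Fin d} (hab : a ≠ b) :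
    X (a, a) (a, a) = X (a, a) (b, b) + X (a, b) (a, b) + X (a, b) (b, a) := by
  -- The reflection along `v` mixes `a` and `b` with the rational coefficients `3/5` and `4/5`. Sign
  -- changes and permutations alone cannot relate the diagonal entry to the other three.
  set v : Fin d → ℝ := Pi.single a 1 - Pi.single b 2 with hv
  have hvv : v ⬝ᵥ v = 5 := by
    simp [hv, hab, hab.symm]; norm_num
  set O : Matrix (Fin d) (Fin d) ℝ := 1 - (2 / 5 : ℝ) • Matrix.vecMulVec v v with hOdef
  have hOt : O.transpose = O := by
    rw [hOdef]
    ext i j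
    simp [Matrix.vecMulVec_apply, Matrix.one_apply, eq_comm, mul_comm]
  have hO : O ∈ Matrix.orthogonalGroup (Fin d) ℝ := by
    rw [Matrix.mem_orthogonalGroup_iff, hOt, hOdef]
    simp only [mul_sub, sub_mul, mul_one, one_mul, Matrix.smul_mul, Matrix.mul_smul,
      Matrix.vecMulVec_mul_vecMulVec, hvv]
    ext i j
    simp [Matrix.vecMulVec_apply]
    ring
  have hcola (f : Fin d → ℂ) : ∑ m, (O m a : ℂ) * f m = 3 / 5 * f a + 4 / 5 * f b := by
    simp [hOdef, hv, Matrix.vecMulVec_apply, Matrix.one_apply, Pi.single_apply, hab,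
      apply_ite Complex.ofReal, sub_mul, mul_sub, Finset.sum_sub_distrib]
    ring
  have hcolb (f : Fin d → ℂ) : ∑ m, (O m b : ℂ) * f m = 4 / 5 * f a - 3 / 5 * f b := by
    simp [hOdef, hv, Matrix.vecMulVec_apply, Matrix.one_apply, Pi.single_apply,
      apply_ite Complex.ofReal, sub_mul, mul_sub, Finset.sum_sub_distrib, hab.symm]
    ring
  have hrow (f : Fin d → ℂ) : ∑ m, (O a m : ℂ) * f m = 3 / 5 * f a + 4 / 5 * f b := by
    rw [← hcola f]
    refine Finset.sum_congr rfl fun m _ => ?_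
    rw [← congrFun (congrFun hOt a) m]
    simp
  have h := commutant_sum_eq hX hO a a a b
  simp only [hcola, hcolb, hrow] at h
  rw [commutant_apply_eq_zero hX (i := a) (j := a) (k := a) (l := b) (by simp [hab]),
    commutant_apply_eq_zero hX (i := a) (j := a) (k := b) (l := a) (by simp [hab.symm, hab]),
    commutant_apply_eq_zero hX (i := b) (j := b) (k := a) (l := b) (by simp [hab, hab.symm])] at h
  obtain ⟨π, h1, h2⟩ := exists_perm_pair hab hab.symm
  have h3 := commutant_perm hX π b a a b
  rw [h1, h2] at h3
  rw [← h3] at h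
  linear_combination (25 / 12) * h

/-- Permutation invariance leaves one value for each of the three pairings of the four indices, and
the reflection fixes the fully diagonal entries as their sum. The pairings are the supports of `Ω`,
`1` and the flip. -/
theorem commutant_eq_span {d : ℕ} (hd : 2 ≤ d) {X : BipMat d}
    (hX : X ∈ orthogonalCommutant d) :
    ∃ a b c : ℂ, X = a • omegaState d + b • 1 + c • flipOp d := by
  let x : Fin d := ⟨0, by omega⟩
  let y : Fin d := ⟨1, by omega⟩
  have hxy : x ≠ y := by simp [x, y]
  have ha {i k : Fin d} (hik : i ≠ k) : X (i, i) (k, k) = X (x, x) (y, y) := by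
    obtain ⟨π, rfl, rfl⟩ := exists_perm_pair hxy hik
    exact commutant_perm hX π _ _ _ _
  have hb {i k : Fin d} (hik : i ≠ k) : X (i, k) (i, k) = X (x, y) (x, y) := by
    obtain ⟨π, rfl, rfl⟩ := exists_perm_pair hxy hik
    exact commutant_perm hX π _ _ _ _
  have hc {i k : Fin d} (hik : i ≠ k) : X (i, k) (k, i) = X (x, y) (y, x) := by
    obtain ⟨π, rfl, rfl⟩ := exists_perm_pair hxy hik
    exact commutant_perm hX π _ _ _ _
  have he (i : Fin d) : X (i, i) (i, i) =
      X (x, x) (y, y) + X (x, y) (x, y) + X (x, y) (y, x) := by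
    obtain ⟨k, hk⟩ : ∃ k : Fin d, i ≠ k := by
      by_cases h : i = x
      · exact ⟨y, h ▸ hxy⟩
      · exact ⟨x, h⟩
    rw [commutant_apply_diag hX hk, ha hk, hb hk, hc hk]
  refine ⟨d * X (x, x) (y, y), X (x, y) (x, y), X (x, y) (y, x), ?_⟩
  have hd' : (d : ℂ) ≠ 0 := Nat.cast_ne_zero.mpr (by omega)
  ext ⟨i, j⟩ ⟨k, l⟩
  simp only [Matrix.add_apply, Matrix.smul_apply, omegaState_apply, flipOp_apply,
    Matrix.one_apply, Prod.swap_prod_mk, Prod.mk.injEq, smul_eq_mul]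
  by_cases h : (i = j ∧ k = l) ∨ (i = k ∧ j = l) ∨ (i = l ∧ j = k)
  · rcases h with ⟨rfl, rfl⟩ | ⟨rfl, rfl⟩ | ⟨rfl, rfl⟩
    · by_cases hik : i = k
      · subst hik
        simp [he, hd', mul_comm]
      · simp [ha hik, hik, Ne.symm hik, hd', mul_comm]
    · by_cases hij : i = j
      · subst hij
        simp [he, hd', mul_comm]
      · simp [hb hij, hij, Ne.symm hij]
    · by_cases hij : i = j
      · subst hij
        simp [he, hd', mul_comm]
      · simp [hc hij, hij, Ne.symm hij]
  · rw [commutant_apply_eq_zero hX h]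
    push Not at h
    obtain ⟨h1, h2, h3⟩ := h
    rw [if_neg (fun h => h1 h.1 h.2), if_neg (fun h => h2 h.1 h.2),
      if_neg (fun h => h3 h.2.symm h.1.symm)]
    simp

theorem eq_covariantState_of_commutant {d : ℕ} (hd : 2 ≤ d) {X : BipMat d}
    (hX : X ∈ orthogonalCommutant d) (hherm : X.IsHermitian) :
    X = covariantState d fun i => projWeight i X := by
  have h0 : d ≠ 0 := by omega
  obtain ⟨a, b, c, hX'⟩ := commutant_eq_span hd hX
  obtain ⟨x, hx⟩ : ∃ x : Fin 3 → ℂ, X = ∑ i, x i • minimalProj d i := by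
    -- The eigenvalues of `a • Ω + b • 1 + c • F` on the ranges of the projections: the flip is `-1`
    -- on `P₁` and `1` on the other two.
    refine ⟨![a + b + c, b - c, b + c], ?_⟩
    rw [hX']
    simp only [Fin.sum_univ_three, minimalProj, Matrix.cons_val, Matrix.cons_val_one,
      Matrix.cons_val_zero]
    module
  have htr (i : Fin 3) : (minimalProj d i * X).trace = x i * projRank d i := by
    conv_lhs => rw [hx]
    rw [Finset.mul_sum, Matrix.trace_sum, Finset.sum_eq_single i]
    · rw [Matrix.mul_smul, minimalProj_mul_self h0, Matrix.trace_smul, trace_minimalProj h0,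
        smul_eq_mul]
    · intro j _ hj
      rw [Matrix.mul_smul, minimalProj_mul_of_ne h0 hj.symm]
      simp
    · simp
  have hreal (i : Fin 3) : ((projWeight i X : ℝ) : ℂ) = (minimalProj d i * X).trace := by
    apply Complex.conj_eq_iff_re.mp
    rw [← Complex.star_def, ← Matrix.trace_conjTranspose, Matrix.conjTranspose_mul, hherm.eq,
      conjTranspose_minimalProj, Matrix.trace_mul_comm]
  rw [covariantState_eq_sum h0]
  conv_lhs => rw [hx]
  refine Finset.sum_congr rfl fun i _ => ?_
  have hr : (projRank d i : ℂ) ≠ 0 := by exact_mod_cast (projRank_pos hd i).ne'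
  have h : x i = ((projWeight i X / projRank d i : ℝ) : ℂ) := by
    rw [Complex.ofReal_div, hreal, htr, mul_div_cancel_right₀ _ hr]
  rw [h]
  rfl

theorem projWeight_nonneg {d : ℕ} (hd : d ≠ 0) {X : BipMat d} (hX : X.PosSemidef) (i : Fin 3) :
    0 ≤ projWeight i X := by
  have h := (hX.mul_mul_conjTranspose_same (minimalProj d i)).trace_nonneg
  rw [conjTranspose_minimalProj, Matrix.trace_mul_comm, ← mul_assoc,
    minimalProj_mul_self hd] at h
  exact (Complex.nonneg_iff.mp h).1

theorem kronecker_mul_flipOp {d : ℕ} (A B : Matrix (Fin d) (Fin d) ℂ) :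
    (A ⊗ₖ B) * flipOp d = flipOp d * (B ⊗ₖ A) := by
  ext p q
  rw [mul_flipOp_apply, flipOp_mul_apply]
  simp [mul_comm]

/-- The transpose trick: on `Ω`, an operator on the first factor can be moved to the second as its
transpose. -/
theorem kronecker_mulVec_omegaVec {d : ℕ} (A B : Matrix (Fin d) (Fin d) ℂ) :
    (A ⊗ₖ B).mulVec (omegaVec d) =
      ((1 : Matrix (Fin d) (Fin d) ℂ) ⊗ₖ (B * A.transpose)).mulVec (omegaVec d) := by
  ext ⟨i, j⟩
  simp [Matrix.mulVec, dotProduct, Fintype.sum_prod_type, omegaVec, Matrix.one_apply,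
    Matrix.mul_apply, Finset.mul_sum, mul_comm]

theorem conj_omegaState {d : ℕ} (M : BipMat d) :
    M * omegaState d * M.conjTranspose =
      Matrix.vecMulVec (M.mulVec (omegaVec d)) (star (M.mulVec (omegaVec d))) := by
  rw [omegaState, Matrix.mul_vecMulVec, Matrix.vecMulVec_mul, Matrix.star_mulVec]

theorem map_ofReal_mul_conjTranspose {d : ℕ} {O : Matrix (Fin d) (Fin d) ℝ}
    (hO : O ∈ Matrix.orthogonalGroup (Fin d) ℝ) :
    O.map Complex.ofReal * (O.map Complex.ofReal).transpose = 1 ∧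
      (O.map Complex.ofReal).transpose * O.map Complex.ofReal = 1 ∧
      (O.map Complex.ofReal).conjTranspose = (O.map Complex.ofReal).transpose := by
  have h1 := (Matrix.mem_orthogonalGroup_iff (Fin d) ℝ).mp hO
  have h2 := (Matrix.mem_orthogonalGroup_iff' (Fin d) ℝ).mp hO
  refine ⟨?_, ?_, ?_⟩
  · have := congrArg (fun M => M.map Complex.ofRealHom) h1
    simp only [Matrix.map_mul, RingHom.map_zero, RingHom.map_one,
      Matrix.map_one] at this
    exact this
  · have := congrArg (fun M => M.map Complex.ofRealHom) h2
    simp only [Matrix.map_mul, RingHom.map_zero, RingHom.map_one,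
      Matrix.map_one] at this
    exact this
  · ext i j
    simp

theorem minimalProj_mem_commutant {d : ℕ} (i : Fin 3) :
    minimalProj d i ∈ orthogonalCommutant d := by
  intro O hO
  obtain ⟨h1, h2, h3⟩ := map_ofReal_mul_conjTranspose hO
  set A := O.map Complex.ofReal
  have hF := (kronecker_mul_flipOp A A).symm
  have hAA : (A ⊗ₖ A) * (A ⊗ₖ A).conjTranspose = 1 ∧ (A ⊗ₖ A).conjTranspose * (A ⊗ₖ A) = 1 := by
    rw [Matrix.conjTranspose_kronecker, h3, ← Matrix.mul_kronecker_mul,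
      ← Matrix.mul_kronecker_mul, h1, h2]
    simp
  have hΩ : omegaState d * (A ⊗ₖ A) = (A ⊗ₖ A) * omegaState d := by
    have h : (A ⊗ₖ A) * omegaState d * (A ⊗ₖ A).conjTranspose = omegaState d := by
      rw [conj_omegaState, kronecker_mulVec_omegaVec, h1]
      simp [omegaState]
    conv_lhs => rw [← h]
    rw [mul_assoc, hAA.2, mul_one]
  fin_cases i
  · exact hΩ
  · simp only [minimalProj, Fin.mk_one, Matrix.cons_val_one, Matrix.cons_val_zero,
      Matrix.smul_mul, Matrix.mul_smul, mul_sub, sub_mul, mul_one, one_mul, hF]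
  · simp only [minimalProj, Fin.reduceFinMk, Matrix.cons_val, Matrix.smul_mul, Matrix.mul_smul,
      mul_sub, sub_mul, mul_add, add_mul, mul_one, one_mul, hF, hΩ]

theorem covariantState_mem_commutant {d : ℕ} (hd : d ≠ 0) (q : Fin 3 → ℝ) :
    covariantState d q ∈ orthogonalCommutant d := by
  intro O hO
  rw [covariantState_eq_sum hd, Finset.sum_mul, Finset.mul_sum]
  refine Finset.sum_congr rfl fun i _ => ?_
  rw [Matrix.smul_mul, Matrix.mul_smul, minimalProj_mem_commutant i O hO]

/-! ### Channels from Jamiolkowski matrices; description of `𝒮 ∩ G'`. -/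

/-- The linear map with Jamiolkowski matrix `C`. -/
noncomputable def choiMap {d : ℕ} (C : BipMat d) :
    Matrix (Fin d) (Fin d) ℂ →ₗ[ℂ] Matrix (Fin d) (Fin d) ℂ where
  toFun X := Matrix.of fun a b => d * ∑ i, ∑ j, X i j * C (i, a) (j, b)
  map_add' X Y := by
    ext a b
    simp [add_mul, Finset.sum_add_distrib, mul_add]
  map_smul' c X := by
    ext a b
    simp only [Matrix.of_apply, Matrix.smul_apply, smul_eq_mul, RingHom.id_apply, Finset.mul_sum]
    exact Finset.sum_congr rfl fun i _ => Finset.sum_congr rfl fun j _ => by ring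

theorem choiMap_apply {d : ℕ} (C : BipMat d) (X : Matrix (Fin d) (Fin d) ℂ) (a b : Fin d) :
    choiMap C X a b = d * ∑ i, ∑ j, X i j * C (i, a) (j, b) := rfl

theorem jamiolkowski_choiMap {d : ℕ} (C : BipMat d) : jamiolkowski (choiMap C) = C := by
  ext p q
  have hd : (d : ℂ) ≠ 0 := by
    have : 0 < d := p.1.pos
    exact_mod_cast this.ne'
  simp [jamiolkowski, ampliation, choiMap_apply, omegaState_apply, ite_and, hd]

theorem isCompletelyPositive_choiMap {d : ℕ} {C : BipMat d} (hC : C.PosSemidef) :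
    IsCompletelyPositive (choiMap C) := by
  intro n X hX
  have hH := (hX.kronecker hC).submatrix
    (fun r : (Fin n × Fin d) × Fin d => ((r.1.1, r.2), (r.2, r.1.2)))
  -- The reindexing identifies the second index of `X` with the first of `C`. Compression by `J`
  -- then sums this shared index out independently on the row and column sides, which is the action
  -- of `choiMap`.
  set J : Matrix ((Fin n × Fin d) × Fin d) (Fin n × Fin d) ℂ :=
    Matrix.of fun r p => if r.1 = p then 1 else 0 with hJ
  have h := (hH.conjTranspose_mul_mul_same J).smul (Nat.cast_nonneg (α := ℝ) d)
  suffices heq : ampliation (choiMap C) X = (d : ℝ) • (J.conjTranspose *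
      ((X ⊗ₖ C).submatrix (fun r : (Fin n × Fin d) × Fin d => ((r.1.1, r.2), (r.2, r.1.2)))
        (fun r : (Fin n × Fin d) × Fin d => ((r.1.1, r.2), (r.2, r.1.2)))) * J) by
    rw [heq]; exact h
  ext p q
  simp only [ampliation, Matrix.of_apply, choiMap_apply, Matrix.smul_apply, Matrix.mul_apply,
    Matrix.conjTranspose_apply, Matrix.submatrix_apply, Matrix.kronecker_apply, hJ,
    Fintype.sum_prod_type (α₁ := Fin n × Fin d), apply_ite star, star_one, star_zero, ite_mul,
    one_mul, zero_mul, mul_ite, mul_one, mul_zero, Finset.sum_ite_irrel, Finset.sum_const_zero,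
    Finset.sum_ite_eq', Finset.mem_univ, if_true]
  rw [Finset.sum_comm]
  simp

theorem isUnitalChannel_choiMap {d : ℕ} {C : BipMat d} (hC : C.PosSemidef)
    (h1 : ∀ i j, ∑ a, C (i, a) (j, a) = if i = j then (d : ℂ)⁻¹ else 0)
    (h2 : ∀ a b, ∑ i, C (i, a) (i, b) = if a = b then (d : ℂ)⁻¹ else 0) :
    IsUnitalChannel (choiMap C) where
  completelyPositive := isCompletelyPositive_choiMap hC
  tracePreserving X := by
    simp only [Matrix.trace, Matrix.diag_apply, choiMap_apply]
    rw [← Finset.mul_sum, Finset.sum_comm]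
    simp_rw [Finset.sum_comm (s := (Finset.univ : Finset (Fin d))) (t := Finset.univ)
      (f := fun a j => X _ j * C (_, a) (j, a)), ← Finset.mul_sum, h1]
    simp only [mul_ite, mul_zero, Finset.sum_ite_eq, Finset.mem_univ, if_true]
    rw [← Finset.sum_mul, mul_left_comm]
    rcases Nat.eq_zero_or_pos d with rfl | hd
    · simp
    · rw [mul_inv_cancel₀ (by exact_mod_cast hd.ne'), mul_one]
  unital := by
    ext a b
    have hd : (d : ℂ) ≠ 0 := by
      have : 0 < d := a.pos
      exact_mod_cast this.ne'
    simp [choiMap_apply, Matrix.one_apply, h2, hd]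

theorem covariantState_mem_unitalStates {d : ℕ} (hd : 2 ≤ d) {q : Fin 3 → ℝ}
    (hq : q ∈ stdSimplex ℝ (Fin 3)) : covariantState d q ∈ unitalStates d := by
  have h0 : d ≠ 0 := by omega
  have hd0 : (d : ℂ) ≠ 0 := Nat.cast_ne_zero.mpr h0
  refine ⟨choiMap (covariantState d q), isUnitalChannel_choiMap
    (posSemidef_covariantState hd hq.1) ?_ ?_, jamiolkowski_choiMap _⟩
  all_goals
    have hr := fun i => (projRank_pos hd i).ne'
    have hsum : q 0 + q 1 + q 2 = 1 := by rw [← Fin.sum_univ_three]; exact hq.2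
    have hr1 := hr 1
    have hr2 := hr 2
    intro i j
    simp only [covariantState_eq_sum h0, Fin.sum_univ_three, Matrix.add_apply, Matrix.smul_apply,
      Finset.sum_add_distrib, ← Finset.smul_sum, minimalProj, Matrix.cons_val,
      Matrix.cons_val_one, Matrix.cons_val_zero, Matrix.sub_apply, omegaState_apply, flipOp_apply,
      Matrix.one_apply, Prod.swap_prod_mk, Prod.mk.injEq, Finset.sum_sub_distrib]
    have hsum' : (q 0 + q 1 + q 2 : ℂ) = 1 := by exact_mod_cast hsum
    have hr1' : (projRank d 1 : ℂ) ≠ 0 := by exact_mod_cast hr1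
    have hr2' : (projRank d 2 : ℂ) ≠ 0 := by exact_mod_cast hr2
    have e1 : (projRank d 1 : ℂ) = d * (d - 1) / 2 := by simp [projRank]
    have e2 : (projRank d 2 : ℂ) = d * (d + 1) / 2 - 1 := by simp [projRank]
    have e0 : (projRank d 0 : ℂ) = 1 := by simp [projRank]
    by_cases hij : i = j
    · subst hij
      simp [ite_and, e0]
      field_simp
      rw [e1, e2]
      linear_combination (d * (d - 1) * (d * (d + 1) / 2 - 1) : ℂ) * hsum'
    · simp [hij, ite_and, Ne.symm hij]

theorem posSemidef_jamiolkowski {d : ℕ}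
    {T : Matrix (Fin d) (Fin d) ℂ →ₗ[ℂ] Matrix (Fin d) (Fin d) ℂ}
    (hT : IsCompletelyPositive T) : (jamiolkowski T).PosSemidef :=
  hT d _ (Matrix.posSemidef_vecMulVec_self_star _)

theorem trace_jamiolkowski {d : ℕ} (hd : d ≠ 0)
    {T : Matrix (Fin d) (Fin d) ℂ →ₗ[ℂ] Matrix (Fin d) (Fin d) ℂ}
    (hT : ∀ X, (T X).trace = X.trace) : (jamiolkowski T).trace = 1 := by
  rw [← trace_omegaState hd]
  simp only [Matrix.trace, Matrix.diag_apply, jamiolkowski, ampliation, Matrix.of_apply,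
    Fintype.sum_prod_type]
  exact Finset.sum_congr rfl fun i _ => hT _

theorem eq_covariantState_of_mem {d : ℕ} (hd : 2 ≤ d) {ρ : BipMat d}
    (hρ : ρ ∈ unitalStates d ∩ orthogonalCommutant d) :
    (fun i => projWeight i ρ) ∈ stdSimplex ℝ (Fin 3) ∧
      ρ = covariantState d fun i => projWeight i ρ := by
  obtain ⟨⟨T, hT, rfl⟩, hc⟩ := hρ
  have hpos := posSemidef_jamiolkowski hT.completelyPositive
  refine ⟨⟨fun i => projWeight_nonneg (by omega) hpos i, ?_⟩,
    eq_covariantState_of_commutant hd hc hpos.isHermitian⟩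
  rw [sum_projWeight, trace_jamiolkowski (by omega) hT.tracePreserving, Complex.one_re]

theorem jamiolkowski_wernerHolevo {d : ℕ} (hd : 2 ≤ d) :
    jamiolkowski (wernerHolevo d) = extremeState d 1 := by
  have h0 : (d : ℂ) ≠ 0 := Nat.cast_ne_zero.mpr (by omega)
  have h1 : (d : ℂ) - 1 ≠ 0 := by
    rw [sub_ne_zero]
    exact_mod_cast (by omega : d ≠ 1)
  rw [extremeState_eq_smul (by omega)]
  ext ⟨i, a⟩ ⟨j, b⟩
  simp only [jamiolkowski, ampliation, wernerHolevo, LinearMap.coe_mk, AddHom.coe_mk,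
    Matrix.of_apply, Matrix.smul_apply, Matrix.sub_apply, Matrix.transpose_apply,
    Matrix.trace, Matrix.diag_apply, omegaState_apply, Matrix.one_apply, minimalProj,
    projRank, Matrix.cons_val_one, Matrix.cons_val_zero, flipOp_apply, Prod.swap_prod_mk,
    Prod.mk.injEq, smul_eq_mul, Complex.real_smul, ite_and, Finset.sum_ite_eq, Finset.mem_univ,
    if_true]
  push_cast
  have h (x : ℂ) : ((d : ℂ) * (d - 1) / 2)⁻¹ * (1 / 2 * x) = (d - 1 : ℂ)⁻¹ * ((d : ℂ)⁻¹ * x) := by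
    field_simp
  rw [h]
  congr 1
  grind

/-! ### Compactness of `𝒰` and the coordinates of unitary states. -/

/-- By Carathéodory, `finrank + 1` points suffice, so the hull is a continuous image of a simplex
times a power of `s`. -/
theorem IsCompact.convexHull_of_finiteDimensional {E : Type*} [AddCommGroup E] [Module ℝ E]
    [TopologicalSpace E] [ContinuousAdd E] [ContinuousSMul ℝ E] [FiniteDimensional ℝ E]
    {s : Set E} (hs : IsCompact s) : IsCompact (convexHull ℝ s) := by
  rcases s.eq_empty_or_nonempty with rfl | ⟨x₀, hx₀⟩
  · simp
  set N := Module.finrank ℝ E + 1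
  have hK : IsCompact (stdSimplex ℝ (Fin N) ×ˢ Set.pi Set.univ fun _ : Fin N => s) :=
    (isCompact_stdSimplex ℝ (Fin N)).prod (isCompact_univ_pi fun _ => hs)
  have hcont : Continuous fun p : (Fin N → ℝ) × (Fin N → E) => ∑ i, p.1 i • p.2 i := by
    fun_prop
  convert hK.image hcont
  apply Set.Subset.antisymm
  · intro x hx
    obtain ⟨ι, hι, z, w, hz, hind, hw, hsum, rfl⟩ := eq_pos_convex_span_of_mem_convexHull hx
    have hcard : Fintype.card ι ≤ Fintype.card (Fin N) := by
      rw [Fintype.card_fin]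
      exact hind.card_le_finrank_succ.trans (Nat.succ_le_succ (Submodule.finrank_le _))
    obtain ⟨e⟩ := Function.Embedding.nonempty_of_card_le hcard
    have hw0 (i : Fin N) (hi : i ∉ Set.range e) : Function.extend e w 0 i = 0 := by
      rw [Function.extend_apply' _ _ _ hi]; rfl
    -- A shorter combination is padded to length `N` with weight `0` at the arbitrary point `x₀`.
    refine ⟨(Function.extend e w 0, Function.extend e z fun _ => x₀), ⟨⟨fun i => ?_, ?_⟩, ?_⟩, ?_⟩
    · by_cases hi : i ∈ Set.range e
      · obtain ⟨j, rfl⟩ := hi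
        simp only [e.injective.extend_apply]
        exact (hw j).le
      · exact (hw0 i hi).ge
    · rw [← hsum]
      refine (Fintype.sum_of_injective e e.injective _ _ hw0 fun i => ?_).symm
      exact (e.injective.extend_apply _ _ _).symm
    · intro i _
      by_cases hi : i ∈ Set.range e
      · obtain ⟨j, rfl⟩ := hi
        simp only [e.injective.extend_apply]
        exact hz ⟨j, rfl⟩
      · simp only [Function.extend_apply' _ _ _ hi, hx₀]
    · refine (Fintype.sum_of_injective e e.injective _ _ (fun i hi => ?_) fun i => ?_).symm
      · simp only [hw0 i hi, zero_smul]
      · simp only [e.injective.extend_apply]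
  · rintro _ ⟨⟨w, z⟩, ⟨⟨hw, hsum⟩, hz⟩, rfl⟩
    exact (convex_convexHull ℝ s).sum_mem (fun i _ => hw i) hsum
      fun i _ => subset_convexHull ℝ s (hz i trivial)

/-- The Jamiolkowski state of conjugation by `U`. -/
noncomputable def unitaryState {d : ℕ} (U : Matrix (Fin d) (Fin d) ℂ) : BipMat d :=
  ((1 : Matrix (Fin d) (Fin d) ℂ) ⊗ₖ U) * omegaState d *
    ((1 : Matrix (Fin d) (Fin d) ℂ) ⊗ₖ U.conjTranspose)

theorem unitaryState_eq_conj {d : ℕ} (U : Matrix (Fin d) (Fin d) ℂ) :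
    unitaryState U = ((1 : Matrix (Fin d) (Fin d) ℂ) ⊗ₖ U) * omegaState d *
      ((1 : Matrix (Fin d) (Fin d) ℂ) ⊗ₖ U).conjTranspose := by
  rw [unitaryState, Matrix.conjTranspose_kronecker, Matrix.conjTranspose_one]

theorem unitaryMixtures_eq (d : ℕ) : unitaryMixtures d =
    convexHull ℝ (unitaryState '' (Matrix.unitaryGroup (Fin d) ℂ : Set _)) := by
  rw [unitaryMixtures]
  congr 1
  ext σ
  constructor
  · rintro ⟨U, hU, rfl⟩
    exact ⟨U, hU, rfl⟩
  · rintro ⟨U, hU, rfl⟩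
    exact ⟨U, hU, rfl⟩

theorem unitaryState_mem {d : ℕ} {U : Matrix (Fin d) (Fin d) ℂ}
    (hU : U ∈ Matrix.unitaryGroup (Fin d) ℂ) : unitaryState U ∈ unitaryMixtures d :=
  subset_convexHull _ _ ⟨U, hU, rfl⟩

theorem isCompact_unitaryGroup (d : ℕ) :
    IsCompact (Matrix.unitaryGroup (Fin d) ℂ : Set (Matrix (Fin d) (Fin d) ℂ)) := by
  have hK : @IsCompact (Matrix (Fin d) (Fin d) ℂ) _
      (Set.pi Set.univ fun _ : Fin d => Set.pi Set.univ fun _ : Fin d =>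
      Metric.closedBall (0 : ℂ) 1) :=
    isCompact_univ_pi fun _ => isCompact_univ_pi fun _ => isCompact_closedBall _ _
  refine hK.of_isClosed_subset isClosed_unitary fun U hU i _ j _ => ?_
  simpa using entry_norm_bound_of_unitary hU i j

theorem convex_unitaryMixtures (d : ℕ) : Convex ℝ (unitaryMixtures d) := convex_convexHull _ _

theorem unitaryState_apply {d : ℕ} (U : Matrix (Fin d) (Fin d) ℂ) (p q : Fin d × Fin d) :
    unitaryState U p q = (d : ℂ)⁻¹ * (U p.2 p.1 * star (U q.2 q.1)) := by
  have h (p : Fin d × Fin d) :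
      ((1 : Matrix (Fin d) (Fin d) ℂ) ⊗ₖ U).mulVec (omegaVec d) p =
        U p.2 p.1 * ((1 / Real.sqrt d : ℝ) : ℂ) := by
    simp [Matrix.mulVec, dotProduct, Fintype.sum_prod_type, omegaVec, Matrix.one_apply]
  have hs : ((1 / Real.sqrt d : ℝ) : ℂ) * ((1 / Real.sqrt d : ℝ) : ℂ) = (d : ℂ)⁻¹ := by
    rw [← Complex.ofReal_mul, div_mul_div_comm, Real.mul_self_sqrt (Nat.cast_nonneg d)]
    simp
  rw [unitaryState_eq_conj, conj_omegaState, Matrix.vecMulVec_apply, Pi.star_apply, h, h, star_mul',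
    ← hs]
  have hc : star ((1 / Real.sqrt d : ℝ) : ℂ) = ((1 / Real.sqrt d : ℝ) : ℂ) := Complex.conj_ofReal _
  rw [hc]
  ring

theorem isCompact_unitaryMixtures (d : ℕ) : IsCompact (unitaryMixtures d) := by
  rw [unitaryMixtures_eq]
  refine ((isCompact_unitaryGroup d).image ?_).convexHull_of_finiteDimensional
  refine continuous_matrix fun p q => ?_
  simp only [unitaryState_apply]
  exact continuous_const.mul ((continuous_id.matrix_elem _ _).mul
    (continuous_id.matrix_elem _ _).star)

theorem posSemidef_unitaryState {d : ℕ} (U : Matrix (Fin d) (Fin d) ℂ) :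
    (unitaryState U).PosSemidef := by
  rw [unitaryState_eq_conj, conj_omegaState]
  exact Matrix.posSemidef_vecMulVec_self_star _

theorem posSemidef_of_mem_unitaryMixtures {d : ℕ} {σ : BipMat d} (hσ : σ ∈ unitaryMixtures d) :
    σ.PosSemidef := by
  have hconv : Convex ℝ {X : BipMat d | X.PosSemidef} := fun X hX Y hY a b ha hb _ =>
    (hX.smul ha).add (hY.smul hb)
  rw [unitaryMixtures_eq] at hσ
  refine convexHull_min ?_ hconv hσ
  rintro _ ⟨U, -, rfl⟩
  exact posSemidef_unitaryState U

theorem trace_mul_conjTranspose_of_unitary {n : Type*} [Fintype n] [DecidableEq n]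
    {U : Matrix n n ℂ} (hU : U ∈ Matrix.unitaryGroup n ℂ) :
    ∑ i, ∑ j, U i j * star (U i j) = Fintype.card n := by
  have h := congrArg Matrix.trace (Matrix.mem_unitaryGroup_iff.mp hU)
  simpa [Matrix.trace, Matrix.mul_apply, Matrix.star_eq_conjTranspose] using h

theorem trace_unitaryState {d : ℕ} (hd : d ≠ 0) {U : Matrix (Fin d) (Fin d) ℂ}
    (hU : U ∈ Matrix.unitaryGroup (Fin d) ℂ) : (unitaryState U).trace = 1 := by
  have hd' : (d : ℂ) ≠ 0 := Nat.cast_ne_zero.mpr hd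
  have h := trace_mul_conjTranspose_of_unitary hU
  rw [Finset.sum_comm, Fintype.card_fin] at h
  simp only [Matrix.trace, Matrix.diag_apply, unitaryState_apply, Fintype.sum_prod_type,
    ← Finset.mul_sum, h]
  exact inv_mul_cancel₀ hd'

/-- The overlap of `Ω` with `(1 ⊗ U) Ω` is `tr U / d`. -/
theorem projWeight_zero_unitaryState {d : ℕ} (U : Matrix (Fin d) (Fin d) ℂ) :
    projWeight 0 (unitaryState U) = ‖U.trace‖ ^ 2 / d ^ 2 := by
  have h : (omegaState d * unitaryState U).trace =
      ((‖U.trace‖ ^ 2 / d ^ 2 : ℝ) : ℂ) := by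
    simp only [Matrix.trace, Matrix.diag_apply, omegaState_mul_apply, unitaryState_apply]
    rw [sum_prod_diag fun p => (d : ℂ)⁻¹ * ∑ i, (d : ℂ)⁻¹ * (U i i * star (U p.2 p.1))]
    simp only [← Finset.mul_sum, ← Finset.sum_mul, ← star_sum]
    push_cast
    rw [← Complex.mul_conj', Complex.star_def]
    ring
  rw [projWeight_apply]
  exact (congrArg Complex.re h).trans (Complex.ofReal_re _)

/-- Since `P₁ = (1 - F) / 2`, it suffices that the flip has expectation `tr (U Ū) / d`. -/
theorem projWeight_one_unitaryState {d : ℕ} (hd : d ≠ 0) {U : Matrix (Fin d) (Fin d) ℂ}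
    (hU : U ∈ Matrix.unitaryGroup (Fin d) ℂ) :
    projWeight 1 (unitaryState U) = (1 - (U * U.map star).trace.re / d) / 2 := by
  have h : (flipOp d * unitaryState U).trace = (d : ℂ)⁻¹ * (U * U.map star).trace := by
    simp only [Matrix.trace, Matrix.diag_apply, flipOp_mul_apply, unitaryState_apply,
      Prod.snd_swap, Prod.fst_swap]
    simp only [Matrix.mul_apply, Matrix.map_apply, Fintype.sum_prod_type,
      Finset.mul_sum]
  have h1 : (minimalProj d 1 * unitaryState U).trace =
      (1 / 2 : ℝ) * (1 - (d : ℂ)⁻¹ * (U * U.map star).trace) := by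
    simp only [minimalProj, Matrix.cons_val_one, Matrix.cons_val_zero, Matrix.smul_mul, sub_mul,
      one_mul, Matrix.trace_smul, Matrix.trace_sub, h, trace_unitaryState hd hU]
    simp
  have h2 : ((d : ℂ)⁻¹ * (U * U.map star).trace).re = (U * U.map star).trace.re / d := by
    rw [← Complex.ofReal_natCast, ← Complex.ofReal_inv, Complex.re_ofReal_mul]
    ring
  rw [projWeight_apply, h1, Complex.re_ofReal_mul, Complex.sub_re, h2, Complex.one_re]
  ring

theorem sum_projWeight_of_mem_unitaryMixtures {d : ℕ} (hd : d ≠ 0) {σ : BipMat d}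
    (hσ : σ ∈ unitaryMixtures d) : ∑ i, projWeight i σ = 1 := by
  have hconv : Convex ℝ {X : BipMat d | ∑ i, projWeight i X = 1} := by
    intro X hX Y hY a b _ _ hab
    simp only [Set.mem_ofPred_eq] at hX hY ⊢
    simp only [map_add, map_smul, Finset.sum_add_distrib, smul_eq_mul, ← Finset.mul_sum, hX, hY]
    linarith
  rw [unitaryMixtures_eq] at hσ
  refine convexHull_min ?_ hconv hσ
  rintro _ ⟨U, hU, rfl⟩
  rw [Set.mem_ofPred_eq, sum_projWeight, trace_unitaryState hd hU, Complex.one_re]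

/-! ### Twirling over the orthogonal group. -/

theorem conj_unitaryState {d : ℕ} (A U : Matrix (Fin d) (Fin d) ℂ) :
    (A ⊗ₖ A) * unitaryState U * (A ⊗ₖ A).conjTranspose =
      unitaryState (A * U * A.transpose) := by
  rw [unitaryState_eq_conj, unitaryState_eq_conj]
  have h : (A ⊗ₖ A) * (((1 : Matrix (Fin d) (Fin d) ℂ) ⊗ₖ U) * omegaState d *
      ((1 : Matrix (Fin d) (Fin d) ℂ) ⊗ₖ U).conjTranspose) * (A ⊗ₖ A).conjTranspose =
      (A ⊗ₖ (A * U)) * omegaState d * (A ⊗ₖ (A * U)).conjTranspose := by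
    have : A ⊗ₖ (A * U) = (A ⊗ₖ A) * ((1 : Matrix (Fin d) (Fin d) ℂ) ⊗ₖ U) := by
      rw [← Matrix.mul_kronecker_mul, mul_one]
    rw [this, Matrix.conjTranspose_mul]
    simp only [mul_assoc]
  rw [h, conj_omegaState, conj_omegaState, kronecker_mulVec_omegaVec]

theorem conj_mem_unitaryMixtures {d : ℕ} {O : Matrix (Fin d) (Fin d) ℝ}
    (hO : O ∈ Matrix.orthogonalGroup (Fin d) ℝ) {σ : BipMat d} (hσ : σ ∈ unitaryMixtures d) :
    (O.map Complex.ofReal ⊗ₖ O.map Complex.ofReal) * σ *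
      (O.map Complex.ofReal ⊗ₖ O.map Complex.ofReal).conjTranspose ∈ unitaryMixtures d := by
  obtain ⟨h1, h2, h3⟩ := map_ofReal_mul_conjTranspose hO
  have hconv := (convex_unitaryMixtures d).linear_preimage
    ((LinearMap.mulRight ℝ (O.map Complex.ofReal ⊗ₖ O.map Complex.ofReal).conjTranspose) ∘ₗ
      LinearMap.mulLeft ℝ (O.map Complex.ofReal ⊗ₖ O.map Complex.ofReal))
  rw [unitaryMixtures_eq] at hσ
  refine convexHull_min ?_ hconv hσ
  rintro _ ⟨U, hU, rfl⟩
  have hA : O.map Complex.ofReal ∈ Matrix.unitaryGroup (Fin d) ℂ := by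
    rw [Matrix.mem_unitaryGroup_iff, Matrix.star_eq_conjTranspose, h3, h1]
  have hAt : (O.map Complex.ofReal).transpose ∈ Matrix.unitaryGroup (Fin d) ℂ := by
    rwa [Matrix.transpose_mem_unitaryGroup_iff]
  have := unitaryState_mem (mul_mem (mul_mem hA hU) hAt)
  rw [← conj_unitaryState] at this
  exact this

theorem projWeight_conj {d : ℕ} {O : Matrix (Fin d) (Fin d) ℝ}
    (hO : O ∈ Matrix.orthogonalGroup (Fin d) ℝ) (i : Fin 3) (X : BipMat d) :
    projWeight i ((O.map Complex.ofReal ⊗ₖ O.map Complex.ofReal) * X *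
      (O.map Complex.ofReal ⊗ₖ O.map Complex.ofReal).conjTranspose) = projWeight i X := by
  obtain ⟨h1, h2, h3⟩ := map_ofReal_mul_conjTranspose hO
  have hc := minimalProj_mem_commutant i O hO
  set A := O.map Complex.ofReal
  have hAA : (A ⊗ₖ A).conjTranspose * (A ⊗ₖ A) = 1 := by
    rw [Matrix.conjTranspose_kronecker, h3, ← Matrix.mul_kronecker_mul, h2]
    simp
  rw [projWeight_apply, projWeight_apply, ← mul_assoc, ← mul_assoc, hc, Matrix.trace_mul_comm,
    ← mul_assoc, ← mul_assoc, hAA, one_mul]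

/-- The squared Hilbert–Schmidt norm. -/
noncomputable def hsNormSq {d : ℕ} (X : BipMat d) : ℝ := ∑ p, ∑ q, Complex.normSq (X p q)

theorem hsNormSq_eq_trace {d : ℕ} (X : BipMat d) :
    hsNormSq X = (X * X.conjTranspose).trace.re := by
  simp [hsNormSq, Matrix.trace, Matrix.mul_apply, Complex.mul_conj, Complex.normSq_apply]

/-- Strict convexity of the norm, from the parallelogram law. It makes a norm minimiser over a
convex set unique. -/
theorem eq_of_hsNormSq_le_midpoint {d : ℕ} {X Y : BipMat d} (h : hsNormSq Y = hsNormSq X)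
    (hmid : hsNormSq X ≤ hsNormSq ((1 / 2 : ℝ) • X + (1 / 2 : ℝ) • Y)) : X = Y := by
  have hpar : hsNormSq ((1 / 2 : ℝ) • X + (1 / 2 : ℝ) • Y) + hsNormSq (X - Y) / 4 =
      hsNormSq X / 2 + hsNormSq Y / 2 := by
    simp only [hsNormSq, Finset.sum_div, ← Finset.sum_add_distrib]
    refine Finset.sum_congr rfl fun p _ => Finset.sum_congr rfl fun q _ => ?_
    simp only [Matrix.add_apply, Matrix.sub_apply, Matrix.smul_apply, Complex.normSq_apply,
      Complex.add_re, Complex.add_im, Complex.sub_re, Complex.sub_im, Complex.smul_re,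
      Complex.smul_im, smul_eq_mul]
    ring
  have h0 : hsNormSq (X - Y) ≤ 0 := by linarith
  have h0' : hsNormSq (X - Y) = 0 := le_antisymm h0
    (Finset.sum_nonneg fun p _ => Finset.sum_nonneg fun q _ => Complex.normSq_nonneg _)
  ext p q
  have hp := (Finset.sum_eq_zero_iff_of_nonneg
    fun p _ => Finset.sum_nonneg fun q _ => Complex.normSq_nonneg _).mp h0' p (Finset.mem_univ _)
  have hq := (Finset.sum_eq_zero_iff_of_nonneg fun q _ => Complex.normSq_nonneg _).mp hp q
    (Finset.mem_univ _)
  exact sub_eq_zero.mp (Complex.normSq_eq_zero.mp hq)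

/-- Twirling over the orthogonal group preserves the set of mixtures of unitary channels. -/
theorem twirl_mem_unitaryMixtures {d : ℕ} (hd : 2 ≤ d) {σ : BipMat d}
    (hσ : σ ∈ unitaryMixtures d) :
    covariantState d (fun i => projWeight i σ) ∈ unitaryMixtures d := by
  -- In place of a Haar average, take the element of least Hilbert–Schmidt norm in the compact
  -- convex set `K`. Conjugation by `O ⊗ O` preserves `K` and the norm, so uniqueness of the
  -- minimiser makes it invariant, and its weights determine it.
  set K := unitaryMixtures d ∩ {X | ∀ i, projWeight i X = projWeight i σ} with hKdef
  have hclosed : IsClosed {X : BipMat d | ∀ i, projWeight i X = projWeight i σ} := by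
    simp only [Set.ofPred_forall]
    exact isClosed_iInter fun i => isClosed_eq
      (LinearMap.continuous_of_finiteDimensional (projWeight i)) continuous_const
  have hK : IsCompact K := (isCompact_unitaryMixtures d).inter_right hclosed
  have hcont : Continuous (hsNormSq : BipMat d → ℝ) := by
    unfold hsNormSq
    refine continuous_finsetSum _ fun p _ => continuous_finsetSum _ fun q _ => ?_
    exact Complex.continuous_normSq.comp (continuous_id.matrix_elem p q)
  obtain ⟨X, hXK, hmin⟩ := hK.exists_isMinOn ⟨σ, hσ, fun _ => rfl⟩ hcont.continuousOn
  have hX : X ∈ orthogonalCommutant d := by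
    intro O hO
    obtain ⟨h1, h2, h3⟩ := map_ofReal_mul_conjTranspose hO
    have hmem := conj_mem_unitaryMixtures hO hXK.1
    have hw := projWeight_conj hO (X := X)
    set A := O.map Complex.ofReal
    have hAA : (A ⊗ₖ A).conjTranspose * (A ⊗ₖ A) = 1 := by
      rw [Matrix.conjTranspose_kronecker, h3, ← Matrix.mul_kronecker_mul, h2]
      simp
    set Y := (A ⊗ₖ A) * X * (A ⊗ₖ A).conjTranspose with hY
    have hnorm : hsNormSq Y = hsNormSq X := by
      have : Y * Y.conjTranspose =
          (A ⊗ₖ A) * (X * X.conjTranspose) * (A ⊗ₖ A).conjTranspose := by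
        rw [hY, Matrix.conjTranspose_mul, Matrix.conjTranspose_mul,
          Matrix.conjTranspose_conjTranspose]
        calc _ = (A ⊗ₖ A) * X * ((A ⊗ₖ A).conjTranspose * (A ⊗ₖ A)) *
              (X.conjTranspose * (A ⊗ₖ A).conjTranspose) := by simp only [mul_assoc]
          _ = _ := by rw [hAA]; simp only [mul_assoc, one_mul]
      rw [hsNormSq_eq_trace, hsNormSq_eq_trace, this, Matrix.trace_mul_comm, ← mul_assoc, hAA,
        one_mul]
    have hmid : (1 / 2 : ℝ) • X + (1 / 2 : ℝ) • Y ∈ K := by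
      refine ⟨convex_unitaryMixtures d hXK.1 hmem (by norm_num) (by norm_num) (by norm_num), ?_⟩
      intro i
      rw [map_add, map_smul, map_smul, hw, hXK.2 i, smul_eq_mul]
      ring
    have hXY : X = Y := eq_of_hsNormSq_le_midpoint hnorm (hmin hmid)
    calc X * (A ⊗ₖ A) = Y * (A ⊗ₖ A) := by rw [← hXY]
      _ = (A ⊗ₖ A) * X := by rw [hY, mul_assoc, hAA, mul_one]
  have h := eq_covariantState_of_commutant hd hX (posSemidef_of_mem_unitaryMixtures hXK.1).isHermitian
  rw [funext hXK.2] at h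
  rw [← h]
  exact hXK.1

/-! ### The trace bound in odd dimension and the supporting lines. -/

theorem norm_sum_mul_sq_le {ι : Type*} (s : Finset ι) (f g : ι → ℂ) :
    ‖∑ i ∈ s, f i * g i‖ ^ 2 ≤ (∑ i ∈ s, ‖f i‖ ^ 2) * ∑ i ∈ s, ‖g i‖ ^ 2 := by
  refine le_trans ?_ (Finset.sum_mul_sq_le_sq_mul_sq s (fun i => ‖f i‖) fun i => ‖g i‖)
  gcongr
  refine (norm_sum_le _ _).trans_eq ?_
  simp only [norm_mul]

theorem trace_mul_conjTranspose_self_re {n : Type*} [Fintype n] (A : Matrix n n ℂ) :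
    (A * A.conjTranspose).trace.re = ∑ p : n × n, ‖A p.1 p.2‖ ^ 2 := by
  simp [Fintype.sum_prod_type, Matrix.trace, Matrix.mul_apply, Complex.mul_conj,
    Complex.normSq_eq_norm_sq, -Complex.ofReal_pow]

theorem norm_trace_mul_sq_le {n : Type*} [Fintype n] (A B : Matrix n n ℂ) :
    ‖(A * B).trace‖ ^ 2 ≤
      (A * A.conjTranspose).trace.re * (B * B.conjTranspose).trace.re := by
  have h : (A * B).trace = ∑ p : n × n, A p.1 p.2 * B p.2 p.1 := by
    simp [Fintype.sum_prod_type, Matrix.trace, Matrix.mul_apply]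
  have hB : ∑ p : n × n, ‖B p.1 p.2‖ ^ 2 = ∑ p : n × n, ‖B p.2 p.1‖ ^ 2 :=
    Fintype.sum_equiv (Equiv.prodComm n n) _ _ fun _ => rfl
  rw [h, trace_mul_conjTranspose_self_re, trace_mul_conjTranspose_self_re, hB]
  exact norm_sum_mul_sq_le _ _ _

/-- A matrix of odd size agrees with its transpose on some unit vector. -/
theorem exists_unit_mulVec_eq_transpose {d : ℕ} (hodd : Odd d) (U : Matrix (Fin d) (Fin d) ℂ) :
    ∃ v : Fin d → ℂ, star v ⬝ᵥ v = 1 ∧ U.mulVec v = U.transpose.mulVec v := by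
  -- An antisymmetric matrix of odd size is singular.
  have hdet : (U - U.transpose).det = 0 := by
    have h : (U - U.transpose).transpose = -(U - U.transpose) := by simp
    have h' := congrArg Matrix.det h
    rw [Matrix.det_transpose, Matrix.det_neg, Fintype.card_fin, hodd.neg_one_pow] at h'
    linear_combination h' / 2
  obtain ⟨v, hv, hUv⟩ := Matrix.exists_mulVec_eq_zero_iff.mpr hdet
  rw [Matrix.sub_mulVec, sub_eq_zero] at hUv
  have hs : star v ⬝ᵥ v = ((∑ i, ‖v i‖ ^ 2 : ℝ) : ℂ) := by
    simp [dotProduct, Complex.conj_mul']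
  set s : ℝ := ∑ i, ‖v i‖ ^ 2 with hsdef
  have hpos : 0 < s := by
    obtain ⟨i, hi⟩ := Function.ne_iff.mp hv
    refine Finset.sum_pos' (fun _ _ => by positivity) ⟨i, Finset.mem_univ _, ?_⟩
    have : 0 < ‖v i‖ := norm_pos_iff.mpr hi
    positivity
  refine ⟨(((Real.sqrt s)⁻¹ : ℝ) : ℂ) • v, ?_, ?_⟩
  · rw [star_smul, smul_dotProduct, dotProduct_smul, hs, Complex.star_def, Complex.conj_ofReal,
      smul_eq_mul, smul_eq_mul, ← mul_assoc, ← Complex.ofReal_mul, ← Complex.ofReal_mul,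
      ← mul_inv, Real.mul_self_sqrt hpos.le, inv_mul_cancel₀ hpos.ne', Complex.ofReal_one]
  · rw [Matrix.mulVec_smul, Matrix.mulVec_smul, hUv]

/-- The trace of an odd-dimensional unitary, bounded by the size of its symmetric part. -/
theorem norm_trace_le_of_unitary {d : ℕ} (hodd : Odd d) {U : Matrix (Fin d) (Fin d) ℂ}
    (hU : U ∈ Matrix.unitaryGroup (Fin d) ℂ) :
    0 ≤ ((d : ℝ) + (U * U.map star).trace.re) / 2 - 1 ∧
    ‖U.trace‖ ≤ 1 + Real.sqrt (((d : ℝ) - 1) *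
      (((d : ℝ) + (U * U.map star).trace.re) / 2 - 1)) := by
  obtain ⟨v, hv, hUv⟩ := exists_unit_mulVec_eq_transpose hodd U
  have hUU : U * U.conjTranspose = 1 := Matrix.mem_unitaryGroup_iff.mp hU
  have hUU' : U.conjTranspose * U = 1 := Matrix.mem_unitaryGroup_iff'.mp hU
  set w := U.mulVec v with hw
  have hww : star w ⬝ᵥ w = 1 := by
    rw [hw, Matrix.star_mulVec, ← Matrix.dotProduct_mulVec, Matrix.mulVec_mulVec, hUU',
      Matrix.one_mulVec, hv]
  set S : Matrix (Fin d) (Fin d) ℂ := (1 / 2 : ℂ) • (U + U.transpose) with hS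
  have hSv : S.mulVec v = w := by
    rw [hS, Matrix.smul_mulVec, Matrix.add_mulVec, ← hUv]
    module
  -- `S v = w` with `v`, `w` unit vectors, so subtracting `w v*` lowers the squared Hilbert–Schmidt
  -- norm of `S` by exactly `1`.
  set R := S - Matrix.vecMulVec w (star v) with hR
  have hRR : R * R.conjTranspose = S * S.conjTranspose - Matrix.vecMulVec w (star w) := by
    have h1 : (Matrix.vecMulVec w (star v)).conjTranspose = Matrix.vecMulVec v (star w) := by
      rw [Matrix.conjTranspose_vecMulVec, star_star]
    have h2 : Matrix.vecMulVec w (star v) * S.conjTranspose = Matrix.vecMulVec w (star w) := by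
      rw [Matrix.vecMulVec_mul, ← Matrix.star_mulVec, hSv]
    rw [hR, Matrix.conjTranspose_sub, h1, sub_mul, mul_sub, mul_sub, Matrix.mul_vecMulVec, hSv, h2,
      Matrix.vecMulVec_mul_vecMulVec, hv, one_smul]
    abel
  have hSS : (S * S.conjTranspose).trace.re = ((d : ℝ) + (U * U.map star).trace.re) / 2 := by
    have h1 : U.conjTranspose.transpose = U.map star := by ext; simp
    have h1' : U.transpose.conjTranspose = U.map star := by ext; simp
    have h2 : S.conjTranspose = (1 / 2 : ℂ) • (U.conjTranspose + U.map star) := by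
      rw [hS, Matrix.conjTranspose_smul, Matrix.conjTranspose_add, h1']
      simp
    have h3 : (U.transpose * U.conjTranspose).trace = (U * U.map star).trace := by
      rw [← Matrix.trace_transpose, Matrix.transpose_mul, Matrix.transpose_transpose, h1,
        Matrix.trace_mul_comm]
    have h4 : (U.transpose * U.map star).trace = d := by
      rw [← h1, ← Matrix.transpose_mul, Matrix.trace_transpose, hUU']
      simp
    have h5 : (S * S.conjTranspose).trace =
        ((1 / 2 : ℝ) : ℂ) * ((d : ℝ) + (U * U.map star).trace) := by
      rw [h2, hS]
      simp only [Matrix.smul_mul, Matrix.mul_smul, Matrix.trace_smul, add_mul, mul_add,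
        Matrix.trace_add, h3, h4, hUU, Matrix.trace_one, Fintype.card_fin, smul_eq_mul]
      push_cast
      ring
    rw [h5, Complex.re_ofReal_mul, Complex.add_re, Complex.ofReal_re]
    ring
  have hr : (R * R.conjTranspose).trace.re =
      ((d : ℝ) + (U * U.map star).trace.re) / 2 - 1 := by
    rw [hRR, Matrix.trace_sub, Matrix.trace_vecMulVec, dotProduct_comm, hww, Complex.sub_re, hSS,
      Complex.one_re]
  rw [← hr]
  have hr0 : 0 ≤ (R * R.conjTranspose).trace.re := by
    rw [trace_mul_conjTranspose_self_re]
    positivity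
  refine ⟨hr0, ?_⟩
  -- `R` kills `v`, hence `R = R Q`. Cauchy–Schwarz against `Q` rather than `1` yields the factor `d
  -- - 1` instead of `d`.
  set Q : Matrix (Fin d) (Fin d) ℂ := 1 - Matrix.vecMulVec v (star v) with hQ
  have hRQ : R * Q = R := by
    rw [hQ, mul_sub, mul_one, Matrix.mul_vecMulVec, hR, Matrix.sub_mulVec, hSv,
      Matrix.vecMulVec_mulVec, hv]
    simp
  have hQQ : (Q * Q.conjTranspose).trace.re = (d : ℝ) - 1 := by
    have h1 : Q.conjTranspose = Q := by
      rw [hQ, Matrix.conjTranspose_sub, Matrix.conjTranspose_vecMulVec, star_star,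
        Matrix.conjTranspose_one]
    have h2 : Q * Q = Q := by
      rw [hQ, mul_sub, sub_mul, sub_mul, Matrix.vecMulVec_mul_vecMulVec, hv]
      simp
    rw [h1, h2, hQ, Matrix.trace_sub, Matrix.trace_vecMulVec, dotProduct_comm, hv]
    simp
  have hRtr : ‖R.trace‖ ≤ Real.sqrt (((d : ℝ) - 1) * (R * R.conjTranspose).trace.re) := by
    apply Real.le_sqrt_of_sq_le
    have := norm_trace_mul_sq_le R Q
    rwa [hRQ, hQQ, mul_comm] at this
  have hvw : ‖w ⬝ᵥ star v‖ ≤ 1 := by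
    have h1 (u : Fin d → ℂ) (hu : star u ⬝ᵥ u = 1) : ∑ i, ‖u i‖ ^ 2 = 1 := by
      have : star u ⬝ᵥ u = ((∑ i, ‖u i‖ ^ 2 : ℝ) : ℂ) := by
        simp [dotProduct, Complex.conj_mul']
      rw [this] at hu
      exact_mod_cast hu
    have h2 := norm_sum_mul_sq_le Finset.univ w (star v)
    simp only [Pi.star_apply, norm_star, h1 w hww, h1 v hv, mul_one] at h2
    exact (sq_le_one_iff₀ (norm_nonneg _)).mp h2
  have htr : U.trace = w ⬝ᵥ star v + R.trace := by
    rw [hR, Matrix.trace_sub, Matrix.trace_vecMulVec, hS, Matrix.trace_smul, Matrix.trace_add,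
      Matrix.trace_transpose, smul_eq_mul]
    ring
  rw [htr]
  exact (norm_add_le _ _).trans (add_le_add hvw hRtr)

/-- The supporting lines of the region of twirled mixtures of unitary channels. -/
theorem projWeight_le_of_mem_unitaryMixtures {d : ℕ} (hodd : Odd d) {σ : BipMat d}
    (hσ : σ ∈ unitaryMixtures d) {c : ℝ} (hc : 0 ≤ c) :
    d * ((1 + (d - 1) * c) * projWeight 1 σ + d * c * projWeight 0 σ) ≤
      (1 + (d - 1) * c) * (d - 1 + c) := by
  have hd0 : d ≠ 0 := by rintro rfl; exact absurd hodd (by decide)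
  have hd1 : (1 : ℝ) ≤ d := by exact_mod_cast Nat.one_le_iff_ne_zero.mpr hd0
  have hconv : Convex ℝ {X : BipMat d | d * ((1 + (d - 1) * c) * projWeight 1 X +
      d * c * projWeight 0 X) ≤ (1 + (d - 1) * c) * (d - 1 + c)} := by
    intro X hX Y hY a b ha hb hab
    simp only [Set.mem_ofPred_eq] at hX hY ⊢
    simp only [map_add, map_smul, smul_eq_mul]
    calc _ = a * (d * ((1 + (d - 1) * c) * projWeight 1 X + d * c * projWeight 0 X)) +
          b * (d * ((1 + (d - 1) * c) * projWeight 1 Y + d * c * projWeight 0 Y)) := by ring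
      _ ≤ a * ((1 + (d - 1) * c) * (d - 1 + c)) + b * ((1 + (d - 1) * c) * (d - 1 + c)) := by
        gcongr
      _ = _ := by rw [← add_mul, hab, one_mul]
  rw [unitaryMixtures_eq] at hσ
  refine convexHull_min ?_ hconv hσ
  rintro _ ⟨U, hU, rfl⟩
  rw [Set.mem_ofPred_eq, projWeight_zero_unitaryState, projWeight_one_unitaryState hd0 hU]
  obtain ⟨hr, htr⟩ := norm_trace_le_of_unitary hodd hU
  set r := ((d : ℝ) + (U * U.map star).trace.re) / 2 - 1 with hrdef
  have hN : (U * U.map star).trace.re = 2 * (r + 1) - d := by rw [hrdef]; ring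
  rw [hN]
  have hx := Real.sq_sqrt (mul_nonneg (sub_nonneg.mpr hd1) hr)
  set x := Real.sqrt (((d : ℝ) - 1) * r)
  have hx0 : 0 ≤ x := Real.sqrt_nonneg _
  have hsq : ‖U.trace‖ ^ 2 ≤ (1 + x) ^ 2 := by gcongr
  have hd' : (d : ℝ) ≠ 0 := by positivity
  have hlhs : (d : ℝ) * ((1 + (d - 1) * c) * ((1 - (2 * (r + 1) - d) / d) / 2) +
      d * c * (‖U.trace‖ ^ 2 / d ^ 2)) =
      (1 + (d - 1) * c) * (d - 1 - r) + c * ‖U.trace‖ ^ 2 := by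
    field_simp
    ring
  -- The terms `(d - 1) c r` cancel in the goal, leaving this inequality. It is a perfect square
  -- over `d - 1`, with equality at `x = (d - 1) c`, which is where the line touches the curve.
  have hkey : 2 * c * x ≤ r + (d - 1) * c ^ 2 := by
    rcases hd1.eq_or_lt with h | h
    · have : x = 0 := by
        rw [← h, sub_self, zero_mul] at hx
        exact pow_eq_zero_iff two_ne_zero |>.mp hx
      rw [this, ← h]
      simpa using hr
    · have h1 : 0 < (d : ℝ) - 1 := sub_pos.mpr h
      nlinarith [sq_nonneg (x - (d - 1) * c)]
  have h1 := mul_le_mul_of_nonneg_left hsq hc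
  rw [hlhs]
  nlinarith

/-! ### Points of the plane attained by unitaries. -/

/-- The covariant operator with weights `x`, `y` and `1 - x - y`. -/
noncomputable def planarState (d : ℕ) (x y : ℝ) : BipMat d := covariantState d ![x, y, 1 - x - y]

/-- The index type is arbitrary so that block matrices indexed by sums can be used. -/
theorem planarState_mem_of_unitary {d : ℕ} (hd : 2 ≤ d) {n : Type*} [Fintype n] [DecidableEq n]
    (hn : Fintype.card n = d) {U : Matrix n n ℂ} (hU : U ∈ Matrix.unitaryGroup n ℂ) :
    planarState d (‖U.trace‖ ^ 2 / d ^ 2) ((1 - (U * U.map star).trace.re / d) / 2) ∈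
      unitaryMixtures d := by
  let e : n ≃ Fin d := Fintype.equivFinOfCardEq hn
  set V : Matrix (Fin d) (Fin d) ℂ := U.submatrix e.symm e.symm with hVdef
  have htr (A : Matrix n n ℂ) : (A.submatrix e.symm e.symm).trace = A.trace :=
    Fintype.sum_equiv e.symm _ _ fun _ => rfl
  have hV : V ∈ Matrix.unitaryGroup (Fin d) ℂ := by
    rw [Matrix.mem_unitaryGroup_iff, Matrix.star_eq_conjTranspose, hVdef,
      Matrix.conjTranspose_submatrix, Matrix.submatrix_mul_equiv,
      ← Matrix.star_eq_conjTranspose, Matrix.mem_unitaryGroup_iff.mp hU,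
      Matrix.submatrix_one_equiv]
  have hVV : (V * V.map star).trace = (U * U.map star).trace := by
    rw [hVdef, ← Matrix.submatrix_map, Matrix.submatrix_mul_equiv, htr]
  have h := twirl_mem_unitaryMixtures hd (unitaryState_mem hV)
  have hsum := sum_projWeight_of_mem_unitaryMixtures (by omega) (unitaryState_mem hV)
  rw [Fin.sum_univ_three] at hsum
  have h0 := projWeight_zero_unitaryState V
  have h1 := projWeight_one_unitaryState (by omega) hV
  rw [hVV] at h1
  rw [hVdef, htr, ← hVdef] at h0
  rw [planarState, ← h0, ← h1]
  convert h using 2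
  ext i
  fin_cases i
  · rfl
  · rfl
  · simp only [Fin.reduceFinMk, Matrix.cons_val]
    linarith

theorem planarState_convex {d : ℕ} {x y x' y' a b : ℝ}
    (h : planarState d x y ∈ unitaryMixtures d) (h' : planarState d x' y' ∈ unitaryMixtures d)
    (ha : 0 ≤ a) (hb : 0 ≤ b) (hab : a + b = 1) :
    planarState d (a * x + b * x') (a * y + b * y') ∈ unitaryMixtures d := by
  convert convex_unitaryMixtures d h h' ha hb hab using 1
  rw [planarState, planarState, planarState, ← covariantState_smul, ← covariantState_smul,
    ← covariantState_add]
  congr 1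
  ext i
  fin_cases i
  · simp
  · simp
  · simp
    linear_combination hab.symm

theorem planarState_one_zero_mem {d : ℕ} (hd : 2 ≤ d) :
    planarState d 1 0 ∈ unitaryMixtures d := by
  have hd' : (d : ℝ) ≠ 0 := by
    have : 0 < d := by omega
    positivity
  have h := planarState_mem_of_unitary hd (Fintype.card_fin d) (one_mem (Matrix.unitaryGroup _ ℂ))
  have h1 : (1 : Matrix (Fin d) (Fin d) ℂ).map star = 1 := Matrix.map_one _ (star_zero _) (star_one _)
  rw [h1, mul_one, Matrix.trace_one, Fintype.card_fin, Complex.natCast_re, Complex.norm_natCast,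
    div_self hd', div_self (pow_ne_zero 2 hd')] at h
  simpa using h

/-- The diagonal matrix of all `d`-th roots of unity has trace zero and, being symmetric, satisfies
`U Ū = 1`. This puts `ρ₂`, the origin of all the rays, in `𝒰`. -/
theorem planarState_zero_zero_mem {d : ℕ} (hd : 2 ≤ d) :
    planarState d 0 0 ∈ unitaryMixtures d := by
  have hd0 : d ≠ 0 := by omega
  have hd' : (d : ℝ) ≠ 0 := Nat.cast_ne_zero.mpr hd0
  set ζ := Complex.exp (2 * Real.pi * Complex.I / d) with hζdef
  have hζ : IsPrimitiveRoot ζ d := Complex.isPrimitiveRoot_exp d hd0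
  have hnorm : ζ * star ζ = 1 := by
    rw [Complex.star_def, Complex.mul_conj', hζ.norm'_eq_one hd0]
    simp
  have hpow (k : ℕ) : ζ ^ k * star (ζ ^ k) = 1 := by
    rw [star_pow, ← mul_pow, hnorm, one_pow]
  set U : Matrix (Fin d) (Fin d) ℂ := Matrix.diagonal fun i : Fin d => ζ ^ (i : ℕ) with hU
  have hUmem : U ∈ Matrix.unitaryGroup (Fin d) ℂ := by
    rw [Matrix.mem_unitaryGroup_iff, Matrix.star_eq_conjTranspose, hU,
      Matrix.diagonal_conjTranspose, Matrix.diagonal_mul_diagonal]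
    simp only [Pi.star_apply, hpow, Matrix.diagonal_one]
  have htr : U.trace = 0 := by
    rw [hU, Matrix.trace_diagonal, Fin.sum_univ_eq_sum_range (fun i => ζ ^ i),
      hζ.geom_sum_eq_zero (by omega)]
  have hT : (U * U.map star).trace = d := by
    rw [hU, Matrix.diagonal_map (star_zero _), Matrix.diagonal_mul_diagonal, Matrix.trace_diagonal]
    simp only [hpow, Finset.sum_const, Finset.card_univ, Fintype.card_fin, nsmul_eq_mul, mul_one]
  have h := planarState_mem_of_unitary hd (Fintype.card_fin d) hUmem
  rw [htr, hT, Complex.natCast_re, div_self hd'] at h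
  simpa using h

theorem trace_J (m : ℕ) : (Matrix.J (Fin m) ℂ).trace = 0 := by
  simp [Matrix.J, Matrix.trace]

theorem conjTranspose_J (m : ℕ) : (Matrix.J (Fin m) ℂ).conjTranspose = -Matrix.J (Fin m) ℂ := by
  simp [Matrix.J, Matrix.fromBlocks_conjTranspose, Matrix.fromBlocks_neg]

theorem map_star_J (m : ℕ) : (Matrix.J (Fin m) ℂ).map star = Matrix.J (Fin m) ℂ := by
  have h : (Matrix.J (Fin m) ℂ).map star = (Matrix.J (Fin m) ℂ).conjTranspose.transpose := by
    ext; simp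
  rw [h, conjTranspose_J, Matrix.transpose_neg, Matrix.J_transpose, neg_neg]

theorem trace_fromBlocks_diag {m n : Type*} [Fintype m] [Fintype n] (A : Matrix m m ℂ)
    (B : Matrix n n ℂ) : (Matrix.fromBlocks A 0 0 B).trace = A.trace + B.trace := by
  simp [Matrix.trace, Fintype.sum_sum_type]

theorem planarState_directSum_mem {d : ℕ} (hd : 2 ≤ d) {m n : Type*} [Fintype m] [DecidableEq m]
    [Fintype n] [DecidableEq n] (hn : Fintype.card m + Fintype.card n = d)
    {A : Matrix m m ℂ} (hA : A * A.conjTranspose = 1) {B : Matrix n n ℂ}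
    (hB : B * B.conjTranspose = 1) :
    planarState d (‖A.trace + B.trace‖ ^ 2 / d ^ 2)
      ((1 - ((A * A.map star).trace + (B * B.map star).trace).re / d) / 2) ∈
      unitaryMixtures d := by
  have hU : Matrix.fromBlocks A 0 0 B ∈ Matrix.unitaryGroup (m ⊕ n) ℂ := by
    rw [Matrix.mem_unitaryGroup_iff, Matrix.star_eq_conjTranspose,
      Matrix.fromBlocks_conjTranspose, Matrix.fromBlocks_multiply, hA, hB]
    simp
  have h := planarState_mem_of_unitary hd (Fintype.card_sum.trans hn) hU
  rw [Matrix.fromBlocks_map, Matrix.fromBlocks_multiply] at h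
  simpa [trace_fromBlocks_diag, Matrix.map_zero] using h

/-- The extremal curve. -/
theorem planarState_curve_mem {d : ℕ} (hd : 3 ≤ d) (hodd : Odd d) {c : ℝ} (hc : 0 ≤ c)
    (hc1 : c ≤ 1) :
    planarState d ((1 + (d - 1) * c) ^ 2 / d ^ 2) ((d - 1) / d * (1 - c ^ 2)) ∈
      unitaryMixtures d := by
  obtain ⟨m, rfl⟩ := hodd
  have hs := Real.sq_sqrt (show 0 ≤ 1 - c ^ 2 by nlinarith)
  set s := Real.sqrt (1 - c ^ 2)
  set J := Matrix.J (Fin m) ℂ with hJ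
  have hJJ : J * J = -1 := Matrix.J_squared _ _
  have hJtr : J.trace = 0 := trace_J m
  have hs' : (s : ℂ) ^ 2 = 1 - (c : ℂ) ^ 2 := by exact_mod_cast hs
  -- `A ⊕ 1` gives equality in the trace bound: its symmetric part is `c ⊕ 1`, so with `v = w` the
  -- last basis vector the remainder `R` is `c` times the projection `Q`.
  set A : Matrix (Fin m ⊕ Fin m) (Fin m ⊕ Fin m) ℂ := (c : ℂ) • 1 + (s : ℂ) • J with hAdef
  have hA : A * A.conjTranspose = 1 := by
    rw [hAdef, Matrix.conjTranspose_add, Matrix.conjTranspose_smul, Matrix.conjTranspose_smul,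
      Matrix.conjTranspose_one, conjTranspose_J, Complex.star_def, Complex.conj_ofReal,
      Complex.conj_ofReal]
    simp only [add_mul, mul_add, Matrix.smul_mul, Matrix.mul_smul, mul_one, one_mul, mul_neg,
      ← hJ, hJJ, smul_neg, smul_smul]
    have : (c : ℂ) * c + s * s = 1 := by linear_combination hs'
    calc _ = ((c : ℂ) * c + s * s) • (1 : Matrix (Fin m ⊕ Fin m) (Fin m ⊕ Fin m) ℂ) := by module
      _ = 1 := by rw [this, one_smul]
  have hAmap : A.map star = A := by
    rw [hAdef]
    ext i j
    have := congrFun (congrFun (map_star_J m) i) j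
    simp only [Matrix.map_apply, ← hJ] at this
    simp [Matrix.one_apply, apply_ite]
    exact Or.inl this
  have hAtr : A.trace = 2 * m * c := by
    rw [hAdef, Matrix.trace_add, Matrix.trace_smul, Matrix.trace_smul, hJ, trace_J]
    simp
    ring
  have hAAtr : (A * A).trace = 2 * m * (c ^ 2 - s ^ 2) := by
    rw [hAdef]
    simp only [add_mul, mul_add, Matrix.smul_mul, Matrix.mul_smul, mul_one, one_mul, hJJ,
      Matrix.trace_add, Matrix.trace_smul, Matrix.trace_neg, Matrix.trace_one, hJtr]
    simp
    ring
  have h := planarState_directSum_mem (d := 2 * m + 1) (by omega) (n := Unit)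
    (by simp; omega) hA (B := 1) (by simp)
  have h1 : (1 : Matrix Unit Unit ℂ).map star = 1 := Matrix.map_one _ (star_zero _) (star_one _)
  have e1 : ‖(2 * m * c + 1 : ℂ)‖ = 1 + 2 * m * c := by
    have : (2 * m * c + 1 : ℂ) = ((1 + 2 * m * c : ℝ) : ℂ) := by push_cast; ring
    rw [this, Complex.norm_real, Real.norm_of_nonneg (by positivity)]
  have e2 : (2 * m * ((c : ℂ) ^ 2 - s ^ 2) + 1).re = 2 * m * (2 * c ^ 2 - 1) + 1 := by
    have : 2 * m * ((c : ℂ) ^ 2 - s ^ 2) + 1 = ((2 * m * (2 * c ^ 2 - 1) + 1 : ℝ) : ℂ) := by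
      rw [hs']; push_cast; ring
    rw [this, Complex.ofReal_re]
  rw [hAmap, hAtr, hAAtr, h1, mul_one, Matrix.trace_one, Fintype.card_unit, Nat.cast_one, e1, e2] at h
  have hm : ((2 * m + 1 : ℕ) : ℝ) ≠ 0 := by positivity
  convert h using 1
  congr 1
  · push_cast; ring
  · push_cast at hm ⊢; field_simp; ring

/-- A traceless unitary of size `3` whose antisymmetric part is as large as possible. -/
noncomputable def tracelessUnitary : Matrix (Fin 3) (Fin 3) ℂ :=
  let h : ℂ := ((Real.sqrt 2)⁻¹ : ℝ)
  !![1 / 2, Complex.I / 2, -(Complex.I * h); Complex.I / 2, -1 / 2, -h; Complex.I * h, h, 0]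

theorem tracelessUnitary_properties :
    tracelessUnitary * tracelessUnitary.conjTranspose = 1 ∧ tracelessUnitary.trace = 0 ∧
      (tracelessUnitary * tracelessUnitary.map star).trace = -1 := by
  have hh : (((Real.sqrt 2)⁻¹ : ℝ) : ℂ) * (((Real.sqrt 2)⁻¹ : ℝ) : ℂ) = 1 / 2 := by
    rw [← Complex.ofReal_mul, ← mul_inv, Real.mul_self_sqrt (by norm_num)]
    norm_num
  have hconj : star (((Real.sqrt 2)⁻¹ : ℝ) : ℂ) = (((Real.sqrt 2)⁻¹ : ℝ) : ℂ) :=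
    Complex.conj_ofReal _
  have hI : star Complex.I = -Complex.I := Complex.conj_I
  have hI2 := Complex.I_mul_I
  unfold tracelessUnitary
  generalize (((Real.sqrt 2)⁻¹ : ℝ) : ℂ) = h at hh hconj
  refine ⟨?_, ?_, ?_⟩
  · ext i j
    fin_cases i <;> fin_cases j <;>
      simp [Matrix.mul_apply, Fin.sum_univ_three, -Complex.star_def, -RCLike.star_def, hconj, hI] <;>
      grind
  · simp [Matrix.trace, Fin.sum_univ_three]
    norm_num
  · simp only [Matrix.trace, Matrix.diag_apply, Matrix.mul_apply, Matrix.map_apply,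
      Fin.sum_univ_three]
    simp [-Complex.star_def, -RCLike.star_def, hconj, hI]
    grind

/-- `J` is antisymmetric, and the symmetric part of `tracelessUnitary` has rank one and norm one, of
the form `w v*` with `v` orthogonal to `w`. The direct sum thus has the least possible symmetric
part, yet trace zero. -/
theorem planarState_zero_max_mem {d : ℕ} (hd : 3 ≤ d) (hodd : Odd d) :
    planarState d 0 ((d - 1) / d) ∈ unitaryMixtures d := by
  obtain ⟨m, rfl⟩ : ∃ m, d = 2 * m + 3 := by
    obtain ⟨m, rfl⟩ := hodd
    exact ⟨m - 1, by omega⟩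
  obtain ⟨hB, hBtr, hBB⟩ := tracelessUnitary_properties
  have hJJ : Matrix.J (Fin m) ℂ * Matrix.J (Fin m) ℂ = -1 := Matrix.J_squared _ _
  have hA : Matrix.J (Fin m) ℂ * (Matrix.J (Fin m) ℂ).conjTranspose = 1 := by
    rw [conjTranspose_J, mul_neg, hJJ, neg_neg]
  have h := planarState_directSum_mem (d := 2 * m + 3) (by omega) (by simp; omega) hA hB
  rw [map_star_J, hJJ, hBtr, trace_J, hBB, Matrix.trace_neg, Matrix.trace_one] at h
  have hm : ((2 * m + 3 : ℕ) : ℝ) ≠ 0 := by positivity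
  convert h using 1
  congr 1
  · simp
  · simp only [Fintype.card_sum, Fintype.card_fin, Complex.add_re, Complex.neg_re,
      Complex.natCast_re, Complex.one_re]
    push_cast at hm ⊢
    field_simp
    ring

/-! ### Negativity along rays from `ρ₂`. -/

theorem zero_mem_negativeWeights {d : ℕ} {ρ : BipMat d} (hρ : ρ ∈ unitaryMixtures d) :
    (0 : ℝ) ∈ negativeWeights d ρ :=
  ⟨le_rfl, 1, zero_le_one, ρ, hρ, ρ, hρ, by simp⟩

theorem IsLeast.negativity_eq {d : ℕ} {ρ : BipMat d} {a : ℝ}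
    (h : IsLeast (negativeWeights d ρ) a) : negativity d ρ = a := h.csInf_eq

theorem negativity_eq_zero {d : ℕ} {ρ : BipMat d} (hρ : ρ ∈ unitaryMixtures d) :
    negativity d ρ = 0 :=
  IsLeast.negativity_eq ⟨zero_mem_negativeWeights hρ, fun _ h => h.1⟩

/-- A linear functional with values in `[0, 1]` on the mixtures of unitary channels certifies the
optimality of a decomposition. -/
theorem isLeast_negativeWeights {d : ℕ} (hd : d ≠ 0) {ρ σ τ : BipMat d}
    (hσ : σ ∈ unitaryMixtures d) (hτ : τ ∈ unitaryMixtures d) {a : ℝ} (ha : 1 ≤ a)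
    (hρ : ρ = a • σ + (1 - a) • τ) (W : BipMat d →ₗ[ℝ] ℝ)
    (hW0 : ∀ X ∈ unitaryMixtures d, 0 ≤ W X) (hW1 : ∀ X ∈ unitaryMixtures d, W X ≤ 1)
    (hWσ : W σ = 1) (hWτ : W τ = 0) : IsLeast (negativeWeights d ρ) (a - 1) := by
  constructor
  · refine ⟨sub_nonneg.mpr ha, a, zero_le_one.trans ha, σ, hσ, τ, hτ, ?_⟩
    rw [hρ]
    module
  · rintro b ⟨hb, p, hp, μ, hμ, ν, hν, h⟩
    have hsum : ∀ X ∈ unitaryMixtures d, ∑ i, projWeight i X = 1 :=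
      fun X hX => sum_projWeight_of_mem_unitaryMixtures hd hX
    -- The trace gives `p = 1 + b`; applying `W` next gives `a = p W(μ) - b W(ν) ≤ p`.
    have h1 := congrArg (fun X => ∑ i, projWeight i X) (hρ.symm.trans h)
    simp only [map_add, map_sub, map_smul, Finset.sum_add_distrib, Finset.sum_sub_distrib,
      smul_eq_mul, ← Finset.mul_sum, hsum σ hσ, hsum τ hτ, hsum μ hμ, hsum ν hν] at h1
    have h2 := congrArg W (hρ.symm.trans h)
    simp only [map_add, map_sub, map_smul, smul_eq_mul, hWσ, hWτ] at h2
    have h3 := mul_le_mul_of_nonneg_left (hW1 μ hμ) hp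
    have h4 := mul_nonneg hb (hW0 ν hν)
    linarith

theorem projWeight_planarState {d : ℕ} (hd : 2 ≤ d) (x y : ℝ) :
    projWeight 0 (planarState d x y) = x ∧ projWeight 1 (planarState d x y) = y := by
  simp [planarState, projWeight_covariantState hd]

theorem covariantState_eq_planarState {d : ℕ} {q : Fin 3 → ℝ} (hq : q ∈ stdSimplex ℝ (Fin 3)) :
    covariantState d q = planarState d (q 0) (q 1) := by
  have h := hq.2
  rw [Fin.sum_univ_three] at h
  rw [planarState]
  congr 1
  ext i
  fin_cases i
  · rfl
  · rfl
  · simp only [Fin.reduceFinMk, Matrix.cons_val]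
    linarith

theorem planarState_mul {d : ℕ} (a x y : ℝ) :
    planarState d (a * x) (a * y) = a • planarState d x y + (1 - a) • planarState d 0 0 := by
  rw [planarState, planarState, planarState, ← covariantState_smul, ← covariantState_smul,
    ← covariantState_add]
  congr 1
  ext i
  fin_cases i
  · simp
  · simp
  · simp
    ring

/-- The negativity of a state on the ray through a point where a supporting line touches. -/
theorem isLeast_negativeWeights_planarState {d : ℕ} (hd : 3 ≤ d) (hodd : Odd d) {x y a c : ℝ}
    (hc : 0 ≤ c) (ha : 0 ≤ a) (hxy : planarState d x y ∈ unitaryMixtures d)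
    (hline : d * ((1 + (d - 1) * c) * y + d * c * x) = (1 + (d - 1) * c) * (d - 1 + c))
    (hρ : planarState d (a * x) (a * y) ∉ unitaryMixtures d) :
    IsLeast (negativeWeights d (planarState d (a * x) (a * y))) (a - 1) := by
  have hd0 : d ≠ 0 := by omega
  have hd2 : 2 ≤ d := by omega
  have hd3 : (3 : ℝ) ≤ d := by exact_mod_cast hd
  have h00 := planarState_zero_zero_mem hd2
  have ha1 : 1 ≤ a := by
    by_contra! h
    apply hρ
    rw [planarState_mul]
    exact convex_unitaryMixtures d hxy h00 ha (by linarith) (by ring)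
  have hpos : 0 < (1 + (d - 1) * c) * (d - 1 + c) := by
    have : 0 ≤ ((d : ℝ) - 1) * c := mul_nonneg (by linarith) hc
    exact mul_pos (by linarith) (by linarith)
  have hcoef : 0 ≤ 1 + ((d : ℝ) - 1) * c := by
    have : 0 ≤ ((d : ℝ) - 1) * c := mul_nonneg (by linarith) hc
    linarith
  -- The left side of the supporting line, scaled to equal `1` on it. Its coefficients are
  -- nonnegative and it vanishes at the origin.
  let W : BipMat d →ₗ[ℝ] ℝ := ((1 + (d - 1) * c) * (d - 1 + c))⁻¹ •
    ((d : ℝ) • ((1 + (d - 1) * c) • projWeight 1 + (d * c) • projWeight 0))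
  have hW (X : BipMat d) : W X = ((1 + (d - 1) * c) * (d - 1 + c))⁻¹ *
    (d * ((1 + (d - 1) * c) * projWeight 1 X + d * c * projWeight 0 X)) := rfl
  refine isLeast_negativeWeights hd0 hxy h00 ha1 (planarState_mul a x y) W ?_ ?_ ?_ ?_
  · intro X hX
    have h0 := projWeight_nonneg hd0 (posSemidef_of_mem_unitaryMixtures hX) 0
    have h1 := projWeight_nonneg hd0 (posSemidef_of_mem_unitaryMixtures hX) 1
    rw [hW]
    positivity
  · intro X hX
    rw [hW, inv_mul_le_one₀ hpos]
    exact projWeight_le_of_mem_unitaryMixtures hodd hX hc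
  · rw [hW, (projWeight_planarState hd2 x y).1, (projWeight_planarState hd2 x y).2, hline,
      inv_mul_cancel₀ hpos.ne']
  · rw [hW, (projWeight_planarState hd2 0 0).1, (projWeight_planarState hd2 0 0).2]
    ring

/-! ### The closed formulas and the maximum. -/

/-- Here `c` locates the curve point on the ray `x = q y`, and the closed formula is `1 / y` at that
point. -/
theorem exists_curve_parameter {e q : ℝ} (he : 3 ≤ e) (hq : 1 / (e * (e - 1)) < q) :
    ∃ c : ℝ, 0 ≤ c ∧ c < 1 ∧ q * (e * (e - 1) * (1 - c ^ 2)) = (1 + (e - 1) * c) ^ 2 ∧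
      1 / (e - 2) * (e - 1 + (e + 2 / (e - 2)) * q -
        2 * ((e - 1) / (e - 2)) * Real.sqrt (q ^ 2 + (e - 2) / (e - 1) * q)) =
      e / ((e - 1) * (1 - c ^ 2)) := by
  have he1 : 0 < e - 1 := by linarith
  have he2 : 0 < e - 2 := by linarith
  have he0 : 0 < e := by linarith
  have hq0 : 0 < q := lt_trans (by positivity) hq
  rw [div_lt_iff₀ (by positivity)] at hq
  have hs := Real.sq_sqrt (show 0 ≤ q ^ 2 + (e - 2) / (e - 1) * q by positivity)
  have hs0 := Real.sqrt_nonneg (q ^ 2 + (e - 2) / (e - 1) * q)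
  set s := Real.sqrt (q ^ 2 + (e - 2) / (e - 1) * q)
  have hs' : (e - 1) * s ^ 2 = (e - 1) * q ^ 2 + (e - 2) * q := by
    rw [hs]
    field_simp
  have hD : 0 < e - 1 + e * q := by positivity
  -- This is where the threshold on `q` is used; it gives `c ≥ 0`.
  have hse : 1 ≤ e * s := by
    rw [← abs_of_nonneg (mul_nonneg he0.le hs0), ← one_le_sq_iff_one_le_abs]
    have h : (e - 1) * ((e * s) ^ 2 - 1) = (e * q + (e - 1)) * (q * (e * (e - 1)) - 1) := by
      linear_combination e ^ 2 * hs'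
    have : 0 < (e - 1) * ((e * s) ^ 2 - 1) := by
      rw [h]
      exact mul_pos (by linarith) (by linarith)
    have := pos_of_mul_pos_right this he1.le
    linarith
  have hsq : s < q + 1 := by
    apply lt_of_pow_lt_pow_left₀ 2 (by linarith)
    have : (e - 1) * s ^ 2 < (e - 1) * (q + 1) ^ 2 := by
      rw [hs']
      nlinarith
    exact lt_of_mul_lt_mul_left this he1.le
  -- The larger root of `(e - 1 + e q) c² + 2 c + 1 / (e - 1) - e q = 0`, the equation of the
  -- intersection; a quarter of its discriminant is `(e s)²`.
  obtain ⟨c, hc⟩ : ∃ c, c * (e - 1 + e * q) = e * s - 1 :=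
    ⟨(e * s - 1) / (e - 1 + e * q), div_mul_cancel₀ _ hD.ne'⟩
  have hc0 : 0 ≤ c := by
    by_contra! h
    nlinarith
  have hc1 : c < 1 := by
    by_contra! h
    nlinarith
  have hcurve : q * (e * (e - 1) * (1 - c ^ 2)) = (1 + (e - 1) * c) ^ 2 := by
    have h : (e - 1 + e * q) * (q * (e * (e - 1) * (1 - c ^ 2)) - (1 + (e - 1) * c) ^ 2) = 0 := by
      have h1 : (c * (e - 1 + e * q)) ^ 2 = (e * s - 1) ^ 2 := by rw [hc]
      linear_combination -(e - 1) * h1 - 2 * (e - 1) * hc - e ^ 2 * hs'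
    have := (mul_eq_zero.mp h).resolve_left hD.ne'
    linarith
  refine ⟨c, hc0, hc1, hcurve, ?_⟩
  have hcc : 0 < 1 - c ^ 2 := by nlinarith
  -- Writing `q` and the square root `s` as rational functions of `c` turns the claim into a
  -- rational identity.
  have hqc : q = (1 + (e - 1) * c) ^ 2 / (e * (e - 1) * (1 - c ^ 2)) := by
    rw [eq_div_iff (by positivity), hcurve]
  have hsc : s = (1 + c * (e - 1 + e * q)) / e := by
    rw [hc]
    field_simp
    ring
  rw [hsc, hqc]
  field_simp
  ring

/-- The flat edge is the segment from the traceless point to the start `c = 0` of the curve. -/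
theorem max_weight_mem {d : ℕ} (hd : 3 ≤ d) (hodd : Odd d) {x : ℝ} (hx : 0 ≤ x)
    (hx1 : x ≤ 1 / (d : ℝ) ^ 2) : planarState d x ((d - 1) / d) ∈ unitaryMixtures d := by
  have h0 := planarState_zero_max_mem hd hodd
  have h1 := planarState_curve_mem hd hodd le_rfl zero_le_one
  have hd' : (0 : ℝ) < d := by
    have : 0 < d := by omega
    positivity
  have hb : x * d ^ 2 ≤ 1 := by
    rwa [le_div_iff₀ (by positivity)] at hx1
  convert planarState_convex h1 h0 (a := x * d ^ 2) (b := 1 - x * d ^ 2) (by positivity)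
    (by linarith) (by ring) using 2
  · field_simp
    ring
  · ring

/-- If `q 1 = 0`, the state lies on the segment from `ρ₂` to the state of the identity channel,
which is in `𝒰`. -/
theorem covariantState_weight_pos {d : ℕ} (hd : 3 ≤ d) {q : Fin 3 → ℝ}
    (hq : q ∈ stdSimplex ℝ (Fin 3)) (hρ : covariantState d q ∉ unitaryMixtures d) : 0 < q 1 := by
  refine lt_of_le_of_ne (hq.1 1) fun h => hρ ?_
  have hsum := hq.2
  rw [Fin.sum_univ_three] at hsum
  have h2 := hq.1 2
  have := planarState_convex (planarState_one_zero_mem (d := d) (by omega))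
    (planarState_zero_zero_mem (by omega)) (hq.1 0) (b := 1 - q 0) (by linarith) (by ring)
  rw [covariantState_eq_planarState hq, ← h]
  simpa using this

theorem isLeast_negativeWeights_of_le {d : ℕ} (hd : 3 ≤ d) (hodd : Odd d) {q : Fin 3 → ℝ}
    (hq : q ∈ stdSimplex ℝ (Fin 3)) (hρ : covariantState d q ∉ unitaryMixtures d)
    (h : q 0 / q 1 ≤ 1 / ((d : ℝ) * (d - 1))) :
    IsLeast (negativeWeights d (covariantState d q)) ((d : ℝ) / (d - 1) * q 1 - 1) := by
  have hq1 := covariantState_weight_pos hd hq hρ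
  have hq0 : 0 ≤ q 0 := hq.1 0
  have hd3 : (3 : ℝ) ≤ d := by exact_mod_cast hd
  have hd1 : (0 : ℝ) < d - 1 := by linarith
  have e0 : (d : ℝ) / (d - 1) * q 1 * (q 0 / q 1 * ((d - 1) / d)) = q 0 := by field_simp
  have e1 : (d : ℝ) / (d - 1) * q 1 * ((d - 1) / d) = q 1 := by field_simp
  rw [covariantState_eq_planarState hq, ← e0] at hρ ⊢
  -- Only the third occurrence of `q 1` is the second coordinate; the earlier ones belong to the
  -- scale factor and the slope.
  nth_rw 3 [← e1] at hρ
  nth_rw 3 [← e1]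
  refine isLeast_negativeWeights_planarState hd hodd le_rfl (by positivity)
    (max_weight_mem hd hodd (by positivity) ?_) ?_ hρ
  · calc q 0 / q 1 * ((d - 1) / d) ≤ 1 / ((d : ℝ) * (d - 1)) * ((d - 1) / d) := by gcongr
      _ = 1 / (d : ℝ) ^ 2 := by field_simp
  · field_simp
    ring

theorem exists_isLeast_negativeWeights_of_lt {d : ℕ} (hd : 3 ≤ d) (hodd : Odd d) {q : Fin 3 → ℝ}
    (hq : q ∈ stdSimplex ℝ (Fin 3)) (hρ : covariantState d q ∉ unitaryMixtures d)
    (h : 1 / ((d : ℝ) * (d - 1)) < q 0 / q 1) :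
    IsLeast (negativeWeights d (covariantState d q))
      (1 / ((d : ℝ) - 2) * ((d : ℝ) - 1 + ((d : ℝ) + 2 / ((d : ℝ) - 2)) * (q 0 / q 1)
        - 2 * (((d : ℝ) - 1) / ((d : ℝ) - 2)) *
          Real.sqrt ((q 0 / q 1) ^ 2 + ((d : ℝ) - 2) / ((d : ℝ) - 1) * (q 0 / q 1))) * q 1 - 1) ∧
    1 / ((d : ℝ) - 2) * ((d : ℝ) - 1 + ((d : ℝ) + 2 / ((d : ℝ) - 2)) * (q 0 / q 1)
      - 2 * (((d : ℝ) - 1) / ((d : ℝ) - 2)) *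
        Real.sqrt ((q 0 / q 1) ^ 2 + ((d : ℝ) - 2) / ((d : ℝ) - 1) * (q 0 / q 1))) * q 1 - 1 <
      1 / ((d : ℝ) - 1) := by
  have hq1 := covariantState_weight_pos hd hq hρ
  have hd3 : (3 : ℝ) ≤ d := by exact_mod_cast hd
  have hd1 : (0 : ℝ) < d - 1 := by linarith
  obtain ⟨c, hc0, hc1, hcurve, hval⟩ := exists_curve_parameter hd3 h
  rw [hval]
  have hcc : 0 < 1 - c ^ 2 := by nlinarith
  have hcurve' : q 0 * (d * (d - 1) * (1 - c ^ 2)) = (1 + (d - 1) * c) ^ 2 * q 1 := by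
    rw [← hcurve]
    field_simp
  constructor
  · have e0 : d / ((d - 1) * (1 - c ^ 2)) * q 1 * ((1 + (d - 1) * c) ^ 2 / d ^ 2) = q 0 := by
      rw [← mul_left_inj' (show (d : ℝ) * (d - 1) * (1 - c ^ 2) ≠ 0 by positivity), hcurve']
      field_simp
    have e1 : d / ((d - 1) * (1 - c ^ 2)) * q 1 * ((d - 1) / d * (1 - c ^ 2)) = q 1 := by
      field_simp
    have hmem := planarState_curve_mem hd hodd hc0 hc1.le
    rw [covariantState_eq_planarState hq] at hρ ⊢
    set a := d / ((d - 1) * (1 - c ^ 2)) * q 1 with ha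
    have ha0 : 0 ≤ a := by positivity
    rw [← e0, ← e1] at hρ ⊢
    refine isLeast_negativeWeights_planarState hd hodd hc0 ha0 hmem ?_ hρ
    field_simp
    ring
  · have hsum := hq.2
    rw [Fin.sum_univ_three] at hsum
    have h2 := hq.1 2
    -- This is equivalent to the strict bound. It follows from `q 0 + q 1 ≤ 1`, because
    -- `d(d-1)(1-c²) + (1+(d-1)c)²` exceeds `d(d-1)` by `1 + (d-1)c(2-c) > 0`.
    have h1 : q 1 < 1 - c ^ 2 := by
      have h3 : q 1 * (d * (d - 1) * (1 - c ^ 2) + (1 + (d - 1) * c) ^ 2) ≤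
          d * (d - 1) * (1 - c ^ 2) := by
        have : (q 0 + q 1) * (d * (d - 1) * (1 - c ^ 2)) ≤ 1 * (d * (d - 1) * (1 - c ^ 2)) := by
          gcongr
          linarith
        linarith
      by_contra! h4
      have h5 : (d : ℝ) * (d - 1) < d * (d - 1) * (1 - c ^ 2) + (1 + (d - 1) * c) ^ 2 := by
        nlinarith [mul_nonneg hd1.le hc0, mul_nonneg hd1.le hcc.le]
      have h6 := mul_lt_mul_of_pos_left h5 hq1
      have h7 := mul_le_mul_of_nonneg_right h4 (show 0 ≤ (d : ℝ) * (d - 1) by positivity)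
      linarith
    have h3 : d / ((d - 1) * (1 - c ^ 2)) * q 1 < d / (d - 1) := by
      rw [div_mul_eq_mul_div, div_lt_div_iff₀ (by positivity) hd1]
      have := mul_lt_mul_of_pos_left h1 (show 0 < (d : ℝ) * (d - 1) by positivity)
      linarith
    have h4 : (d : ℝ) / (d - 1) - 1 = 1 / (d - 1) := by
      field_simp
      ring
    linarith

theorem extremeState_one_eq (d : ℕ) :
    extremeState d 1 = covariantState d (Pi.single 1 1) := by
  simp [covariantState, Pi.single_apply, ite_smul]

theorem extremeState_one_notMem {d : ℕ} (hd : 2 ≤ d) (hodd : Odd d) :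
    extremeState d 1 ∉ unitaryMixtures d := by
  intro h
  have h' := projWeight_le_of_mem_unitaryMixtures hodd h le_rfl
  rw [extremeState_one_eq, projWeight_covariantState hd, Pi.single_eq_same] at h'
  linarith

theorem negativity_le_of_mem {d : ℕ} (hd : 3 ≤ d) (hodd : Odd d) {q : Fin 3 → ℝ}
    (hq : q ∈ stdSimplex ℝ (Fin 3)) :
    negativity d (covariantState d q) ≤ 1 / ((d : ℝ) - 1) ∧
      (negativity d (covariantState d q) = 1 / ((d : ℝ) - 1) ↔
        covariantState d q = extremeState d 1) := by
  have hd3 : (3 : ℝ) ≤ d := by exact_mod_cast hd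
  have hd1 : (0 : ℝ) < d - 1 := by linarith
  have hne := extremeState_one_notMem (d := d) (by omega) hodd
  by_cases hρ : covariantState d q ∈ unitaryMixtures d
  · rw [negativity_eq_zero hρ]
    have h0 : 0 < 1 / ((d : ℝ) - 1) := by positivity
    exact ⟨h0.le, fun h => absurd h h0.ne, fun h => absurd (h ▸ hρ) hne⟩
  have hsum := hq.2
  rw [Fin.sum_univ_three] at hsum
  have h0 := hq.1 0
  have h2 := hq.1 2
  rcases le_or_gt (q 0 / q 1) (1 / ((d : ℝ) * (d - 1))) with h | h
  · rw [(isLeast_negativeWeights_of_le hd hodd hq hρ h).negativity_eq]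
    have e : 1 / ((d : ℝ) - 1) = d / (d - 1) * 1 - 1 := by
      field_simp
      ring
    have hpos : 0 < (d : ℝ) / (d - 1) := by positivity
    rw [e]
    refine ⟨by gcongr; linarith, fun h => ?_, fun h => ?_⟩
    · have h1 : q 1 = 1 := mul_left_cancel₀ hpos.ne' (by linarith)
      rw [extremeState_one_eq]
      congr 1
      ext i
      fin_cases i
      · simp
        linarith
      · simpa using h1
      · simp
        linarith
    · have := congrArg (projWeight 1) h
      rw [extremeState_one_eq, projWeight_covariantState (by omega),
        projWeight_covariantState (by omega), Pi.single_eq_same] at this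
      rw [this]
  · obtain ⟨hleast, hlt⟩ := exists_isLeast_negativeWeights_of_lt hd hodd hq hρ h
    rw [hleast.negativity_eq]
    refine ⟨hlt.le, fun h' => absurd h' hlt.ne, fun h' => ?_⟩
    have := congrArg (projWeight 0) h'
    rw [extremeState_one_eq, projWeight_covariantState (by omega),
      projWeight_covariantState (by omega), Pi.single_eq_of_ne (by decide)] at this
    rw [this, zero_div] at h
    exact absurd h (not_lt.mpr (by positivity))

theorem negativeWeights_nonempty {d : ℕ} (hd : 3 ≤ d) (hodd : Odd d) {q : Fin 3 → ℝ}
    (hq : q ∈ stdSimplex ℝ (Fin 3)) : (negativeWeights d (covariantState d q)).Nonempty := by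
  by_cases hρ : covariantState d q ∈ unitaryMixtures d
  · exact ⟨0, zero_mem_negativeWeights hρ⟩
  rcases le_or_gt (q 0 / q 1) (1 / ((d : ℝ) * (d - 1))) with h | h
  · exact ⟨_, (isLeast_negativeWeights_of_le hd hodd hq hρ h).1⟩
  · exact ⟨_, (exists_isLeast_negativeWeights_of_lt hd hodd hq hρ h).1.1⟩

theorem mainTheorem9 (d : ℕ) (hd : 3 ≤ d) (hodd : Odd d) :
    -- every `O(d)`-covariant state in `𝒮` has unique coordinates `q`, and all `q` occur
    (∀ ρ ∈ unitalStates d ∩ orthogonalCommutant d,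
      (∃! q : Fin 3 → ℝ, q ∈ stdSimplex ℝ (Fin 3) ∧ ρ = covariantState d q) ∧
      (negativeWeights d ρ).Nonempty) ∧
    (∀ q ∈ stdSimplex ℝ (Fin 3),
      covariantState d q ∈ unitalStates d ∩ orthogonalCommutant d) ∧
    -- the closed form of the negativity outside `𝒰`
    (∀ q ∈ stdSimplex ℝ (Fin 3), covariantState d q ∉ unitaryMixtures d →
      0 < q 1 ∧
      (q 0 / q 1 ≤ 1 / ((d : ℝ) * (d - 1)) →
        negativity d (covariantState d q) = (d : ℝ) / (d - 1) * q 1 - 1) ∧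
      (1 / ((d : ℝ) * (d - 1)) < q 0 / q 1 →
        negativity d (covariantState d q) =
          1 / ((d : ℝ) - 2) *
            ((d : ℝ) - 1 + ((d : ℝ) + 2 / ((d : ℝ) - 2)) * (q 0 / q 1)
              - 2 * (((d : ℝ) - 1) / ((d : ℝ) - 2)) *
                Real.sqrt ((q 0 / q 1) ^ 2 + ((d : ℝ) - 2) / ((d : ℝ) - 1) * (q 0 / q 1)))
            * q 1 - 1)) ∧
    -- the maximum is attained exactly at the Werner–Holevo channel
    jamiolkowski (wernerHolevo d) = extremeState d 1 ∧
    jamiolkowski (wernerHolevo d) ∈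
      (unitalStates d ∩ orthogonalCommutant d) \ unitaryMixtures d ∧
    (∀ ρ ∈ unitalStates d ∩ orthogonalCommutant d,
      negativity d ρ ≤ 1 / ((d : ℝ) - 1) ∧
      (negativity d ρ = 1 / ((d : ℝ) - 1) ↔ ρ = jamiolkowski (wernerHolevo d))) := by
  have hd2 : 2 ≤ d := by omega
  have hmem {q : Fin 3 → ℝ} (hq : q ∈ stdSimplex ℝ (Fin 3)) :
      covariantState d q ∈ unitalStates d ∩ orthogonalCommutant d :=
    ⟨covariantState_mem_unitalStates hd2 hq, covariantState_mem_commutant (by omega) q⟩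
  refine ⟨fun ρ hρ => ?_, fun q hq => hmem hq, fun q hq hρ => ⟨?_, fun h => ?_, fun h => ?_⟩,
    jamiolkowski_wernerHolevo hd2, ?_, fun ρ hρ => ?_⟩
  · obtain ⟨hq, h⟩ := eq_covariantState_of_mem hd2 hρ
    refine ⟨⟨_, ⟨hq, h⟩, ?_⟩, ?_⟩
    · rintro p ⟨-, hp⟩
      ext i
      rw [hp, projWeight_covariantState hd2]
    · rw [h]
      exact negativeWeights_nonempty hd hodd hq
  · exact covariantState_weight_pos hd hq hρ
  · exact (isLeast_negativeWeights_of_le hd hodd hq hρ h).negativity_eq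
  · exact (exists_isLeast_negativeWeights_of_lt hd hodd hq hρ h).1.negativity_eq
  · rw [jamiolkowski_wernerHolevo hd2]
    refine ⟨?_, extremeState_one_notMem hd2 hodd⟩
    rw [extremeState_one_eq]
    exact hmem (single_mem_stdSimplex ℝ 1)
  · obtain ⟨hq, h⟩ := eq_covariantState_of_mem hd2 hρ
    rw [jamiolkowski_wernerHolevo hd2, h]
    exact negativity_le_of_mem hd hodd hq
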